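/- Let $\mathcal R$ be an ergodic countable probability measure preserving (pmp) equivalence relation on a standard probability space $(X,\mu)$; that is, $\mathcal R\subset X\times X$ is a Borel equivalence relation with countable classes, every element of the full group $[\mathcal R]=\{\theta:X\to X \text{ Borel automorphism} : \theta(x)\in[x]_{\mathcal R}\text{ for all }x\in X\}$ preserves $\mu$, and every $\mathcal R$-invariant Borel subset of $X$ is null or co-null. Suppose that $\mathcal R$ is generated by $\theta_1,\dots,\theta_n\in[\mathcal R]$, i.e. $\mathcal R$ is the smallest equivalence relation containing the graphs of $\theta_1,\dots,\theta_n$. Endow $\mathcal R$ with the Borel measure $m(A)=\int_X|\{y\in[x]_{\mathcal R}:(x,y)\in A\}|\,d\mu(x)$, for $\theta\in[\mathcal R]$ let $u(\theta)$ be the unitary operator on $L^2(\mathcal R,m)$ given by $(u(\theta)f)(x,y)=f(\theta^{-1}(x),y)$, and let $T=\sum_{i=1}^n\big(u(\theta_i)+u(\theta_i^{-1})\big)$. For $x\in X$ let $\mathcal G_x=([x]_{\mathcal R},E_x)$ be the unoriented multigraph with vertex set $[x]_{\mathcal R}$ which has one edge, joining $y$ and $\theta_i(y)$, for every $y\in[x]_{\mathcal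 R}$ and every $i\in\{1,\dots,n\}$ (loops and multiple edges are allowed). Let $p\in(0,1)$, let $\lambda_p$ be the probability measure on $\{0,1\}$ with weights $1-p$ at $0$ and $p$ at $1$, and let $\tilde X$ be the set of pairs $(x,\omega)$ with $x\in X$ and $\omega\in\{0,1\}^{E_x}$. Endow $\tilde X$ with the smallest $\sigma$-algebra that makes measurable the map $(x,\omega)\mapsto x$ and, for all $\gamma\in[\mathcal R]$ and $1\le i\le n$, the map sending $(x,\omega)$ to the value of $\omega$ at the $i$-th edge of $\gamma(x)$ (the one joining $\gamma(x)$ and $\theta_i(\gamma(x))$), and with the probability measure $\tilde\mu$ given by $d\tilde\mu(x,\omega)=d\lambda_p^{E_x}(\omega)\,d\mu(x)$. View each $\omega\in\{0,1\}^{E_x}$ as the subgraph of $\mathcal G_x$ with vertex set $[x]_{\mathcal R}$ and edge set $\{e\in E_x:\omega(e)=1\}$; its connected components are called clusters. If $$\frac{1}{(2n-\|T\|)+1}<p<\frac1{\|T\|},$$ then, for $\tilde\mu$-almost every $(x,\omega)\in\tilde X$, the graph $\omega$ has infinitely many infinite clusters. -/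

import Mathlib

open MeasureTheory

namespace PercolationOnRelations

section Relations

variable {X : Type*} [MeasurableSpace X]

/-- The full group `[R]`: the Borel automorphisms `θ` of `X` with `θ(x) ∈ [x]_R` for all `x`. -/
def FullGroup (R : Setoid X) : Type _ := {θ : X ≃ᵐ X // ∀ x, R x (θ x)}

/-- The inverse of an element of the full group. -/
def FullGroup.inv {R : Setoid X} (θ : FullGroup R) : FullGroup R :=
  ⟨θ.1.symm, fun x => by
    have h := θ.2 (θ.1.symm x)
    rw [MeasurableEquiv.apply_symm_apply] at h
    exact R.symm' h⟩

/-- A countable Borel probability measure preserving (pmp) equivalence relation: it is a Borel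
subset of `X × X`, its classes are countable, and every element of its full group preserves `μ`. -/
structure IsCountablePMP (R : Setoid X) (μ : Measure X) : Prop where
  borel : MeasurableSet {q : X × X | R q.1 q.2}
  countable_class : ∀ x, {y | R x y}.Countable
  measurePreserving : ∀ θ : FullGroup R, MeasurePreserving θ.1 μ μ

/-- `R` is ergodic: every `R`-invariant Borel set is null or co-null. -/
def IsErgodicRel (R : Setoid X) (μ : Measure X) : Prop :=
  ∀ A : Set X, MeasurableSet A → (∀ x y, R x y → (x ∈ A ↔ y ∈ A)) → μ A = 0 ∨ μ Aᶜ = 0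

/-- `R` is generated by `θ_1, …, θ_n`: it is the smallest equivalence relation which contains the
graphs of all the `θ_i`. -/
def IsGeneratedBy (R : Setoid X) {n : ℕ} (θ : Fin n → FullGroup R) : Prop :=
  IsLeast {S : Setoid X | ∀ i x, S x ((θ i).1 x)} R

/-- The relation `R` as a (Borel) space: the set of pairs `(x, y)` with `x R y`, with the
σ-algebra induced from `X × X`. -/
abbrev RelSpace (R : Setoid X) : Type _ := {q : X × X // R q.1 q.2}

/-- The counting measure on the set of pairs `(x, y) ∈ R` with first coordinate `x`. -/
noncomputable def fibreCount (R : Setoid X) (x : X) : Measure (RelSpace R) :=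
  Measure.count.restrict {q | q.1.1 = x}

/-- The measure `m(A) = ∫ |{y ∈ [x]_R : (x, y) ∈ A}| dμ(x)` on `R`
(see `relMeasure_apply` for this formula). -/
noncomputable def relMeasure (R : Setoid X) (μ : Measure X) : Measure (RelSpace R) :=
  μ.bind (fibreCount R)

/-- The map `(x, y) ↦ (θ(x), y)` of `R`. -/
def leftMap {R : Setoid X} (θ : FullGroup R) (q : RelSpace R) : RelSpace R :=
  ⟨(θ.1 q.1.1, q.1.2), R.trans' (R.symm' (θ.2 q.1.1)) q.2⟩

theorem measurable_leftMap {R : Setoid X} (θ : FullGroup R) : Measurable (leftMap θ) :=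
  Measurable.subtype_mk
    ((θ.1.measurable.comp (measurable_fst.comp measurable_subtype_coe)).prodMk
      (measurable_snd.comp measurable_subtype_coe))

theorem leftMap_leftMap_inv {R : Setoid X} (θ : FullGroup R) (q : RelSpace R) :
    leftMap θ (leftMap θ.inv q) = q := by
  apply Subtype.ext
  simp [leftMap, FullGroup.inv]

theorem leftMap_inv_leftMap {R : Setoid X} (θ : FullGroup R) (q : RelSpace R) :
    leftMap θ.inv (leftMap θ q) = q := by
  apply Subtype.ext
  simp [leftMap, FullGroup.inv]

/-- `(x, y) ↦ (θ(x), y)` as a Borel automorphism of `R`. -/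
def leftEquiv {R : Setoid X} (θ : FullGroup R) : RelSpace R ≃ᵐ RelSpace R where
  toFun := leftMap θ
  invFun := leftMap θ.inv
  left_inv := leftMap_inv_leftMap θ
  right_inv := leftMap_leftMap_inv θ
  measurable_toFun := measurable_leftMap θ
  measurable_invFun := measurable_leftMap θ.inv

theorem map_fibreCount {R : Setoid X} (θ : FullGroup R) (x : X) :
    (fibreCount R x).map (leftMap θ) = fibreCount R (θ.1 x) := by
  ext A hA
  have h1 : Measure.count.map (leftEquiv θ) = (Measure.count : Measure (RelSpace R)) := by
    ext B hB
    rw [MeasurableEquiv.map_apply, Measure.count_apply hB,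
      Measure.count_apply ((leftEquiv θ).measurable hB)]
    congr 1
    exact ((leftEquiv θ).toEquiv.injective.injOn.encard_image
      (s := leftEquiv θ ⁻¹' B)).symm.trans
      (congrArg _ (Set.image_preimage_eq B (leftEquiv θ).surjective))
  rw [Measure.map_apply (measurable_leftMap θ) hA, fibreCount, fibreCount,
    Measure.restrict_apply (measurable_leftMap θ hA), Measure.restrict_apply hA]
  conv_rhs => rw [← h1, MeasurableEquiv.map_apply]
  congr 1
  ext q
  simp [leftEquiv, leftMap]

theorem measurePreserving_leftMap {R : Setoid X} {μ : Measure X} (hR : IsCountablePMP R μ)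
    (θ : FullGroup R) : MeasurePreserving (leftMap θ) (relMeasure R μ) (relMeasure R μ) := by
  refine ⟨measurable_leftMap θ, ?_⟩
  by_cases hk : AEMeasurable (fibreCount R) μ
  · ext A hA
    have h := (hR.measurePreserving θ).lintegral_comp_emb θ.1.measurableEmbedding
      (fun x => fibreCount R x A)
    rw [Measure.map_apply (measurable_leftMap θ) hA, relMeasure,
      Measure.bind_apply (measurable_leftMap θ hA) hk, Measure.bind_apply hA hk, ← h]
    refine lintegral_congr fun x => ?_
    rw [← map_fibreCount, Measure.map_apply (measurable_leftMap θ) hA]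
  · simp [relMeasure, Measure.bind, Measure.map_of_not_aemeasurable hk]

/-- The Hilbert space `L²(R, m)`. -/
noncomputable abbrev L2Rel (R : Setoid X) (μ : Measure X) : Type _ := Lp ℂ 2 (relMeasure R μ)

/-- The operator `u(θ)` on `L²(R, m)`, given by `(u(θ) f)(x, y) = f(θ⁻¹(x), y)`. -/
noncomputable def fullGroupRep {R : Setoid X} {μ : Measure X} (hR : IsCountablePMP R μ)
    (θ : FullGroup R) : L2Rel R μ →L[ℂ] L2Rel R μ :=
  (Lp.compMeasurePreservingₗᵢ ℂ (leftMap θ.inv)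
    (measurePreserving_leftMap hR θ.inv)).toContinuousLinearMap

/-- The operator `T = ∑ i, (u(θ_i) + u(θ_i⁻¹))` on `L²(R, m)`. -/
noncomputable def generatorSum {R : Setoid X} {μ : Measure X} (hR : IsCountablePMP R μ) {n : ℕ}
    (θ : Fin n → FullGroup R) : L2Rel R μ →L[ℂ] L2Rel R μ :=
  ∑ i, (fullGroupRep hR (θ i) + fullGroupRep hR (θ i).inv)

end Relations

section Percolation

variable {X : Type*} [MeasurableSpace X]

/-- The equivalence class `[x]_R`, the vertex set of the graph `G_x`. -/
abbrev ClassVertex (R : Setoid X) (x : X) : Type _ := {y : X // R x y}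

/-- The edge set `E_x` of the multigraph `G_x`: the edge with index `(y, i)` is `(y, θ_i(y))`.
Loops and multiple edges are allowed, and edges with different indices are different. -/
abbrev ClassEdge (R : Setoid X) (n : ℕ) (x : X) : Type _ := ClassVertex R x × Fin n

/-- The adjacency relation of the subgraph `ω` of `G_x`: two distinct vertices are adjacent when
some edge of `ω` joins them. (Loops and multiplicities of edges do not affect the connected
components, so that it is enough to record adjacency.) -/
def openSubgraph {R : Setoid X} {n : ℕ} (θ : Fin n → FullGroup R) {x : X}
    (ω : ClassEdge R n x → Bool) : SimpleGraph (ClassVertex R x) :=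
  SimpleGraph.fromRel fun y z => ∃ i, ω (y, i) = true ∧ (θ i).1 y.1 = z.1

/-- `ω` has infinitely many infinite clusters (connected components). -/
def HasInfinitelyManyInfiniteClusters {R : Setoid X} {n : ℕ} (θ : Fin n → FullGroup R) {x : X}
    (ω : ClassEdge R n x → Bool) : Prop :=
  {C : (openSubgraph θ ω).ConnectedComponent | C.supp.Infinite}.Infinite

/-- The space of pairs `(x, ω)` with `x ∈ X` and `ω ∈ {0,1}^{E_x}`. -/
structure PercolationSpace (R : Setoid X) (n : ℕ) where
  /-- the point `x` -/
  root : X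
  /-- the configuration `ω` -/
  config : ClassEdge R n root → Bool

/-- The smallest σ-algebra that makes `(x, ω) ↦ x` and all `(x, ω) ↦ ω(γ(x), θ_i(γ(x)))`
measurable, for `γ ∈ [R]` and `1 ≤ i ≤ n`. -/
instance PercolationSpace.instMeasurableSpace (R : Setoid X) (n : ℕ) :
    MeasurableSpace (PercolationSpace R n) :=
  MeasurableSpace.comap PercolationSpace.root inferInstance ⊔
    ⨆ (γ : FullGroup R) (i : Fin n),
      MeasurableSpace.comap (fun z => z.config (⟨γ.1 z.root, γ.2 z.root⟩, i)) inferInstance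

/-- The law `λ_p^{E_x}` of Bernoulli(`p`) bond percolation on `G_x`: the edges are kept
independently, each with probability `p`. -/
noncomputable def bondPercolation (R : Setoid X) (n : ℕ) (p : unitInterval) (x : X) :
    Measure (ClassEdge R n x → Bool) :=
  Measure.infinitePi fun _ => ProbabilityTheory.bernoulliMeasure true false p

/-- The measure `λ_p^{E_x}`, seen on the fibre over `x` of the space of pairs `(x, ω)`. -/
noncomputable def fibreLaw (R : Setoid X) (n : ℕ) (p : unitInterval) (x : X) :
    Measure (PercolationSpace R n) :=
  (bondPercolation R n p x).map (PercolationSpace.mk x)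

/-- The measure on pairs `(x, ω)` given by `dλ_p^{E_x}(ω) dμ(x)`
(see `percolationMeasure_apply` for this formula). -/
noncomputable def percolationMeasure (R : Setoid X) (n : ℕ) (p : unitInterval) (μ : Measure X) :
    Measure (PercolationSpace R n) :=
  μ.bind (fibreLaw R n p)

end Percolation

/-! The integral formulas for `relMeasure` and `percolationMeasure`. Measurability of the fibre
measures, on which the meaning of `Measure.bind` depends, is proved for a generated relation. -/

section Formulas

variable {X : Type*} [MeasurableSpace X]

theorem exists_enumeration {R : Setoid X} {n : ℕ} {θ : Fin n → FullGroup R}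
    (hgen : IsGeneratedBy R θ) :
    ∃ γ : ℕ → FullGroup R, ∀ x y, R x y → ∃ k, (γ k).1 x = y := by
  let gen : Fin n × Bool → FullGroup R := fun a => if a.2 then θ a.1 else (θ a.1).inv
  let one : FullGroup R := ⟨MeasurableEquiv.refl X, fun x => R.refl' x⟩
  let comp : FullGroup R → FullGroup R → FullGroup R := fun g h =>
    ⟨h.1.trans g.1, fun x => R.trans' (h.2 x) (g.2 _)⟩
  let word : List (Fin n × Bool) → FullGroup R := fun w => w.foldr (fun a g => comp (gen a) g) one
  have hword_append : ∀ v w x, (word (v ++ w)).1 x = (word v).1 ((word w).1 x) := by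
    intro v w x
    induction v with
    | nil => rfl
    | cons a v ih =>
      change (gen a).1 ((word (v ++ w)).1 x) = (gen a).1 ((word v).1 ((word w).1 x))
      rw [ih]
  have hword_inv : ∀ w, ∃ v, ∀ x, (word v).1 ((word w).1 x) = x := by
    intro w
    induction w with
    | nil => exact ⟨[], fun x => rfl⟩
    | cons a w ih =>
      obtain ⟨v, hv⟩ := ih
      refine ⟨v ++ [(a.1, !a.2)], fun x => ?_⟩
      rw [hword_append]
      have : (word [(a.1, !a.2)]).1 ((word (a :: w)).1 x) = (word w).1 x := by
        change (gen (a.1, !a.2)).1 ((gen a).1 ((word w).1 x)) = (word w).1 x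
        rcases a with ⟨i, b⟩
        cases b <;> simp [gen, FullGroup.inv]
      rw [this, hv]
  let S : Setoid X :=
    { r := fun x y => ∃ w, (word w).1 x = y
      iseqv :=
        { refl := fun x => ⟨[], rfl⟩
          symm := by
            rintro x y ⟨w, rfl⟩
            obtain ⟨v, hv⟩ := hword_inv w
            exact ⟨v, hv x⟩
          trans := by
            rintro x y z ⟨w, rfl⟩ ⟨v, rfl⟩
            exact ⟨v ++ w, hword_append v w x⟩ } }
  have hS : R ≤ S := hgen.2 fun i x => ⟨[(i, true)], rfl⟩
  obtain ⟨f, hf⟩ := exists_surjective_nat (List (Fin n × Bool))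
  refine ⟨fun k => word (f k), fun x y hxy => ?_⟩
  obtain ⟨w, hw⟩ := hS hxy
  obtain ⟨k, rfl⟩ := hf w
  exact ⟨k, hw⟩

theorem measurable_percolationSpace_mk (R : Setoid X) (n : ℕ) (x : X) :
    Measurable (PercolationSpace.mk (R := R) (n := n) x) := by
  refine Measurable.of_comap_le ?_
  rw [PercolationSpace.instMeasurableSpace]
  simp only [MeasurableSpace.comap_sup, MeasurableSpace.comap_iSup, MeasurableSpace.comap_comp]
  refine sup_le ?_ (iSup_le fun γ => iSup_le fun i => ?_)
  · exact (measurable_const (a := x)).comap_le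
  · exact (measurable_pi_apply
      (X := fun _ : ClassEdge R n x => Bool) (⟨γ.1 x, γ.2 x⟩, i)).comap_le

variable [StandardBorelSpace X]

theorem measurableSet_first_index {R : Setoid X} (γ : ℕ → FullGroup R) {f : X → X}
    (hf : Measurable f) (k : ℕ) :
    MeasurableSet {x | (γ k).1 x = f x ∧ ∀ j < k, (γ j).1 x ≠ f x} := by
  have h : ∀ j, MeasurableSet {x | (γ j).1 x = f x} := fun j =>
    measurableSet_eq_fun (γ j).1.measurable hf
  have : {x | (γ k).1 x = f x ∧ ∀ j < k, (γ j).1 x ≠ f x} =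
      {x | (γ k).1 x = f x} ∩ ⋂ j ∈ {j | j < k}, {x | (γ j).1 x = f x}ᶜ := by
    ext x; simp
  rw [this]
  exact (h k).inter (MeasurableSet.biInter (Set.to_countable _) fun j _ => (h j).compl)

theorem fibreCount_apply (R : Setoid X) (x : X) {A : Set (RelSpace R)} (hA : MeasurableSet A) :
    fibreCount R x A = {y : ClassVertex R x | (⟨(x, y.1), y.2⟩ : RelSpace R) ∈ A}.encard := by
  have hm : MeasurableSet {q : RelSpace R | q.1.1 = x} :=
    (measurable_fst.comp measurable_subtype_coe) (measurableSet_singleton x)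
  rw [fibreCount, Measure.restrict_apply hA, Measure.count_apply (hA.inter hm)]
  congr 1
  let φ : ClassVertex R x → RelSpace R := fun y => ⟨(x, y.1), y.2⟩
  have hφ : Function.Injective φ := fun y z h =>
    Subtype.ext (congrArg (fun q : RelSpace R => q.1.2) h)
  have himg : A ∩ {q : RelSpace R | q.1.1 = x} = φ '' (φ ⁻¹' A) := by
    ext q
    constructor
    · rintro ⟨hq, hx⟩
      rcases q with ⟨⟨a, b⟩, hab⟩
      obtain rfl : a = x := hx
      exact ⟨⟨b, hab⟩, hq, rfl⟩
    · rintro ⟨y, hy, rfl⟩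
      exact ⟨hy, rfl⟩
  rw [himg, hφ.injOn.encard_image]
  rfl

theorem measurable_fibreCount {R : Setoid X} {n : ℕ} {θ : Fin n → FullGroup R}
    (hgen : IsGeneratedBy R θ) : Measurable (fibreCount R) := by
  classical
  obtain ⟨γ, hγ⟩ := exists_enumeration hgen
  refine Measure.measurable_of_measurable_coe _ fun A hA => ?_
  let s : ℕ → X → RelSpace R := fun k x => ⟨(x, (γ k).1 x), (γ k).2 x⟩
  have hs : ∀ k, Measurable (s k) := fun k =>
    Measurable.subtype_mk (measurable_id.prodMk (γ k).1.measurable)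
  let N : ℕ → Set X := fun k => {x | ∀ j < k, (γ j).1 x ≠ (γ k).1 x} ∩ s k ⁻¹' A
  have hN : ∀ k, MeasurableSet (N k) := fun k => by
    have h := measurableSet_first_index γ (γ k).1.measurable k
    simp only [true_and] at h
    exact h.inter (hs k hA)
  have key : ∀ x, fibreCount R x A = ∑' k, (N k).indicator (fun _ => (1 : ENNReal)) x := by
    intro x
    have h1 : ∑' k, (N k).indicator (fun _ => (1 : ENNReal)) x = ({k | x ∈ N k} : Set ℕ).encard := by
      rw [← ENNReal.tsum_set_one, tsum_subtype ({k | x ∈ N k} : Set ℕ) fun _ => (1 : ENNReal)]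
      rfl
    rw [h1, fibreCount_apply R x hA]
    congr 1
    let ψ : ℕ → ClassVertex R x := fun k => ⟨(γ k).1 x, (γ k).2 x⟩
    have hψ : Set.InjOn ψ {k | x ∈ N k} := by
      intro k hk l hl hkl
      have hkl' : (γ k).1 x = (γ l).1 x := congrArg Subtype.val hkl
      rcases lt_trichotomy k l with h | h | h
      · exact absurd hkl' (hl.1 k h)
      · exact h
      · exact absurd hkl'.symm (hk.1 l h)
    rw [← hψ.encard_image]
    congr 1
    ext y
    constructor
    · intro hy
      have hex := hγ x y.1 y.2
      have hfind := Nat.find_spec hex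
      have heq : ψ (Nat.find hex) = y := Subtype.ext hfind
      refine ⟨Nat.find hex, ⟨fun j hj h => Nat.find_min hex hj (h.trans hfind), ?_⟩, heq⟩
      change (⟨(x, (ψ (Nat.find hex)).1), (ψ (Nat.find hex)).2⟩ : RelSpace R) ∈ A
      rw [heq]
      exact hy
    · rintro ⟨k, hk, rfl⟩
      exact hk.2
  simp_rw [key]
  exact Measurable.tsum fun k => measurable_const.indicator (hN k)

theorem relMeasure_apply {R : Setoid X} {n : ℕ} {θ : Fin n → FullGroup R}
    (hgen : IsGeneratedBy R θ) (μ : Measure X) {A : Set (RelSpace R)} (hA : MeasurableSet A) :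
    relMeasure R μ A =
      ∫⁻ x, ({y : ClassVertex R x | (⟨(x, y.1), y.2⟩ : RelSpace R) ∈ A}.encard : ENNReal) ∂μ := by
  rw [relMeasure, Measure.bind_apply hA (measurable_fibreCount hgen).aemeasurable]
  exact lintegral_congr fun x => fibreCount_apply R x hA

theorem infinitePi_map_comp_injective {ι κ α : Type*} [MeasurableSpace α] (ν : Measure α)
    [IsProbabilityMeasure ν] (φ : ι → κ) (hφ : Function.Injective φ) :
    (Measure.infinitePi fun _ : κ => ν).map (fun ω i => ω (φ i)) =
      Measure.infinitePi fun _ : ι => ν := by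
  classical
  have hm : Measurable (fun (ω : κ → α) (i : ι) => ω (φ i)) :=
    measurable_pi_lambda _ fun i => measurable_pi_apply _
  refine Measure.eq_infinitePi _ fun s t ht => ?_
  rw [Measure.map_apply hm
    (MeasurableSet.pi s.countable_toSet fun i _ => ht i)]
  have hpre : (fun (ω : κ → α) (i : ι) => ω (φ i)) ⁻¹' (Set.pi s t) =
      Set.pi (s.image φ) (Function.extend φ t fun _ => Set.univ) := by
    ext ω
    simp [Set.mem_pi, hφ.extend_apply]
  rw [hpre, Measure.infinitePi_pi]
  · rw [Finset.prod_image fun i _ j _ h => hφ h]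
    simp [hφ.extend_apply]
  · intro j hj
    obtain ⟨i, -, rfl⟩ := Finset.mem_image.1 hj
    rw [hφ.extend_apply]
    exact ht i

theorem measurable_fibreLaw {R : Setoid X} {n : ℕ} {θ : Fin n → FullGroup R}
    (hgen : IsGeneratedBy R θ) (p : unitInterval) : Measurable (fibreLaw R n p) := by
  classical
  obtain ⟨γ, hγ⟩ := exists_enumeration hgen
  let ν : Measure Bool := ProbabilityTheory.bernoulliMeasure true false p
  let P : Measure (ℕ × Fin n → Bool) := Measure.infinitePi fun _ => ν
  let idx : ∀ x, ClassEdge R n x → ℕ × Fin n := fun x e => (Nat.find (hγ x e.1.1 e.1.2), e.2)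
  have hidx : ∀ x, Function.Injective (idx x) := by
    rintro x ⟨y, i⟩ ⟨z, j⟩ h
    obtain ⟨h1, rfl⟩ := Prod.mk.inj h
    have hy := Nat.find_spec (hγ x y.1 y.2)
    have hz := Nat.find_spec (hγ x z.1 z.2)
    have h1' : Nat.find (hγ x y.1 y.2) = Nat.find (hγ x z.1 z.2) := h1
    rw [h1', hz] at hy
    rw [Subtype.ext hy.symm]
  let Ψ : X × (ℕ × Fin n → Bool) → PercolationSpace R n := fun q =>
    ⟨q.1, fun e => q.2 (idx q.1 e)⟩
  have hΨ : Measurable Ψ := by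
    refine Measurable.of_comap_le ?_
    rw [PercolationSpace.instMeasurableSpace]
    simp only [MeasurableSpace.comap_sup, MeasurableSpace.comap_iSup, MeasurableSpace.comap_comp]
    refine sup_le measurable_fst.comap_le (iSup_le fun g => iSup_le fun i => ?_)
    let k : X → ℕ := fun x => Nat.find (hγ x (g.1 x) (g.2 x))
    have hk : Measurable k := by
      refine measurable_to_countable' fun j => ?_
      have h := measurableSet_first_index γ g.1.measurable j
      convert h using 1
      ext x
      exact Nat.find_eq_iff _
    have hev : Measurable fun q : X × (ℕ × Fin n → Bool) => q.2 (k q.1, i) := by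
      have h2 : Measurable fun q : ℕ × (ℕ × Fin n → Bool) => q.2 (q.1, i) :=
        measurable_from_prod_countable_right fun j =>
          measurable_pi_apply (X := fun _ : ℕ × Fin n => Bool) (j, i)
      exact h2.comp ((hk.comp measurable_fst).prodMk measurable_snd)
    exact hev.comap_le
  have key : ∀ x, fibreLaw R n p x = P.map (fun ω => Ψ (x, ω)) := by
    intro x
    have h := infinitePi_map_comp_injective ν (idx x) (hidx x)
    rw [fibreLaw, bondPercolation, ← h, Measure.map_map (measurable_percolationSpace_mk R n x)
      (measurable_pi_lambda _ fun e => measurable_pi_apply _)]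
    rfl
  refine Measure.measurable_of_measurable_coe _ fun A hA => ?_
  have : (fun x => fibreLaw R n p x A) = fun x => P (Prod.mk x ⁻¹' (Ψ ⁻¹' A)) := by
    funext x
    have hx : Measurable fun ω => Ψ (x, ω) := hΨ.comp measurable_prodMk_left
    rw [key, Measure.map_apply hx hA]
    rfl
  rw [this]
  exact measurable_measure_prodMk_left (hΨ hA)

theorem percolationMeasure_apply {R : Setoid X} {n : ℕ} {θ : Fin n → FullGroup R}
    (hgen : IsGeneratedBy R θ) (p : unitInterval) (μ : Measure X)
    {A : Set (PercolationSpace R n)} (hA : MeasurableSet A) :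
    percolationMeasure R n p μ A =
      ∫⁻ x, bondPercolation R n p x {ω | (⟨x, ω⟩ : PercolationSpace R n) ∈ A} ∂μ := by
  rw [percolationMeasure, Measure.bind_apply hA (measurable_fibreLaw hgen p).aemeasurable]
  refine lintegral_congr fun x => ?_
  rw [fibreLaw, Measure.map_apply (measurable_percolationSpace_mk R n x) hA]
  rfl

end Formulas

end PercolationOnRelations

/-! Everything is decided on a single class. Put `t = ‖T‖` and `h = 2n - t`. By the mass transport
principle, `L²(R, m)` disintegrates over the second coordinate `y` into the spaces `ℓ²([y])`, and
`T` acts on each of them as the adjacency operator of the multigraph. Testing `T` on countably many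
measurable families of finite patterns shows that, on almost every class, the adjacency operator is
bounded by `t` (`ae_adjBound`).

This bound is used twice. Applied to the indicator of a finite set `C`, it gives `|∂C| ≥ h |C|`; as
`p > 1 / (h + 1)`, exploring the cluster of a vertex edge by edge, in the manner of Benjamini and
Schramm, shows that it is infinite with probability at least some `c > 0`, uniformly in the vertex
(`exists_le_real_infinite_hull`). Iterated on a point mass, it leaves at most `t ^ k` paths of
length `k` between two vertices; as `p t < 1`, the probability that `v` is connected to a fixed `w`
tends to `0` as `v` goes to infinity (`tendsto_real_reachable`).

If there are finitely many infinite clusters, they all meet some finite set `F`. Let `B` be this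
event for a given `F`, and `A_z` the event that the cluster of `z` is infinite. On `B ∩ A_z` the
vertex `z` is connected to `F`, so `P(B ∩ A_z) → 0`. But the cluster of a remote `z` rarely touches
a given finite set of edges, so `A_z` is asymptotically independent of every event
(`tendsto_real_infiniteHull_inter_sub`) and `P(B) P(A_z) → 0`. Since `P(A_z) ≥ c`, it follows that
`P(B) = 0`, and there are only countably many `F`. -/

namespace PercolationOnRelations

/-! ### Bernoulli percolation and resampling of one edge. -/

section Bernoulli

variable {E : Type*}

/-- Bernoulli(`p`) percolation on an index set `E`. -/
noncomputable def bernoulliPercolation (E : Type*) (p : unitInterval) : Measure (E → Bool) :=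
  Measure.infinitePi fun _ => ProbabilityTheory.bernoulliMeasure true false p

instance (p : unitInterval) : IsProbabilityMeasure (bernoulliPercolation E p) := by
  unfold bernoulliPercolation; infer_instance

theorem measurable_update_prod [DecidableEq E] (e : E) :
    Measurable fun q : Bool × (E → Bool) => Function.update q.2 e q.1 := by
  refine measurable_pi_lambda _ fun a => ?_
  by_cases h : a = e
  · subst h; simpa using measurable_fst
  · simpa [h, Function.comp_def] using
      (measurable_pi_apply (X := fun _ : E => Bool) a).comp (measurable_snd (α := Bool))

/-- Resampling the coordinate `e` preserves the law of Bernoulli percolation. -/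
theorem map_update_bernoulliPercolation [DecidableEq E] (p : unitInterval) (e : E) :
    ((ProbabilityTheory.bernoulliMeasure true false p).prod (bernoulliPercolation E p)).map
      (fun q => Function.update q.2 e q.1) = bernoulliPercolation E p := by
  refine Measure.eq_infinitePi _ fun s t ht => ?_
  rw [Measure.map_apply (measurable_update_prod e)
    (MeasurableSet.pi s.countable_toSet fun i _ => ht i)]
  by_cases he : e ∈ s
  · have : (fun q : Bool × (E → Bool) => Function.update q.2 e q.1) ⁻¹' (Set.pi s t) =
        t e ×ˢ Set.pi (s.erase e : Finset E) t := by
      ext q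
      simp only [Set.mem_preimage, Set.mem_pi, Set.mem_prod, Finset.mem_coe, Finset.mem_erase]
      constructor
      · intro h
        exact ⟨by simpa using h e he, fun i hi => by simpa [hi.1] using h i hi.2⟩
      · rintro ⟨h1, h2⟩ i hi
        by_cases hie : i = e
        · subst hie; simpa using h1
        · simpa [hie] using h2 i ⟨hie, hi⟩
    rw [this, Measure.prod_prod, bernoulliPercolation, Measure.infinitePi_pi _ fun i _ => ht i,
      Finset.mul_prod_erase s (fun i => ProbabilityTheory.bernoulliMeasure true false p (t i)) he]
  · have : (fun q : Bool × (E → Bool) => Function.update q.2 e q.1) ⁻¹' (Set.pi s t) =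
        Set.univ ×ˢ Set.pi s t := by
      ext q
      simp only [Set.mem_preimage, Set.mem_pi, Set.mem_prod, Finset.mem_coe, Set.mem_univ,
        true_and]
      refine forall₂_congr fun i hi => ?_
      rw [Function.update_of_ne (by rintro rfl; exact he hi)]
    rw [this, Measure.prod_prod, bernoulliPercolation, Measure.infinitePi_pi _ fun i _ => ht i]
    simp

theorem bernoulliPercolation_real_eq [DecidableEq E] (p : unitInterval) (e : E)
    {A : Set (E → Bool)} (hA : MeasurableSet A) :
    (bernoulliPercolation E p).real A =
      p * (bernoulliPercolation E p).real ((fun ω => Function.update ω e true) ⁻¹' A) +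
      (1 - p) * (bernoulliPercolation E p).real ((fun ω => Function.update ω e false) ⁻¹' A) := by
  have hm := measurable_update_prod e
  have h := congrArg (fun m => m A) (map_update_bernoulliPercolation p e)
  rw [Measure.map_apply hm hA, Measure.prod_apply (hm hA),
    ProbabilityTheory.bernoulliMeasure_def, lintegral_add_measure, lintegral_smul_measure, lintegral_smul_measure, lintegral_dirac,
    lintegral_dirac] at h
  rw [measureReal_def, ← h, ENNReal.toReal_add, measureReal_def, measureReal_def]
  · simp [ENNReal.smul_def, Set.preimage_preimage]
  · exact ENNReal.mul_ne_top ENNReal.coe_ne_top (measure_ne_top _ _)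
  · exact ENNReal.mul_ne_top ENNReal.coe_ne_top (measure_ne_top _ _)

/-- If `A` does not depend on the coordinate `e`, it is independent of the value at `e`. -/
theorem bernoulliPercolation_real_inter_eval (p : unitInterval) (e : E) (b : Bool)
    {A : Set (E → Bool)} (hA : MeasurableSet A)
    (hinv : ∀ ω ω', (∀ a ≠ e, ω a = ω' a) → ω ∈ A → ω' ∈ A) :
    (bernoulliPercolation E p).real ({ω | ω e = b} ∩ A) =
      (if b then (p : ℝ) else 1 - p) * (bernoulliPercolation E p).real A := by
  classical
  have hup : ∀ c ω, Function.update ω e c ∈ A ↔ ω ∈ A := fun c ω =>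
    ⟨hinv _ _ fun a ha => by simp [ha], hinv _ _ fun a ha => by simp [ha]⟩
  have hb : MeasurableSet {ω : E → Bool | ω e = b} :=
    measurable_pi_apply (X := fun _ : E => Bool) e (measurableSet_singleton b)
  rw [bernoulliPercolation_real_eq p e (hb.inter hA)]
  cases b <;> simp [Set.preimage, hup, Set.inter_def]

end Bernoulli

/-! ### Measurability of reachability for a random relation. -/

section Reachability

/-- `l` can be reached from `k` in `m` steps of the relation `a`. -/
def StepReach {ι : Type*} (a : ι → ι → Prop) (k : ι) : ℕ → ι → Prop
  | 0, l => k = l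
  | m + 1, l => ∃ j, StepReach a k m j ∧ a j l

theorem reflTransGen_iff_stepReach {ι : Type*} {a : ι → ι → Prop} {k l : ι} :
    Relation.ReflTransGen a k l ↔ ∃ m, StepReach a k m l := by
  constructor
  · intro h
    induction h with
    | refl => exact ⟨0, rfl⟩
    | tail _ hb ih =>
      obtain ⟨m, hm⟩ := ih
      exact ⟨m + 1, _, hm, hb⟩
  · rintro ⟨m, hm⟩
    induction m generalizing l with
    | zero => rw [show k = l from hm]
    | succ m ih =>
      obtain ⟨j, hj, hjl⟩ := hm
      exact (ih hj).tail hjl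

theorem measurableSet_reflTransGen {Ω ι : Type*} [MeasurableSpace Ω] [Countable ι]
    {a : Ω → ι → ι → Prop} (h : ∀ k l, MeasurableSet {z | a z k l}) (k l : ι) :
    MeasurableSet {z | Relation.ReflTransGen (a z) k l} := by
  simp only [reflTransGen_iff_stepReach, Set.ofPred_exists]
  refine MeasurableSet.iUnion fun m => ?_
  induction m generalizing l with
  | zero => exact MeasurableSet.const (k = l)
  | succ m ih =>
    simp only [StepReach, Set.ofPred_exists]
    exact MeasurableSet.iUnion fun j => (ih j).inter (h j l)

end Reachability

/-! ### Isoperimetry and infinite clusters: the exploration argument. -/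

section PermGraph

variable {V : Type*} {n : ℕ} (σ : Fin n → Equiv.Perm V)

/-- The neighbour of `v` along the generator `σ_i` or its inverse. -/
def genStep (s : Fin n × Bool) (v : V) : V := if s.2 then σ s.1 v else (σ s.1).symm v

/-- The index of the edge joining `v` and `genStep σ s v`. -/
def genEdge (s : Fin n × Bool) (v : V) : V × Fin n :=
  if s.2 then (v, s.1) else ((σ s.1).symm v, s.1)

/-- The simple graph underlying the set `S` of edges. -/
def edgeGraph (S : Set (V × Fin n)) : SimpleGraph V :=
  SimpleGraph.fromRel fun y z => ∃ i, (y, i) ∈ S ∧ σ i y = z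

/-- The open edges of a configuration. -/
def openEdges {E : Type*} (ω : E → Bool) : Set E := {e | ω e = true}

/-- The vertices joined to `C` by edges of `S`. -/
def hull (S : Set (V × Fin n)) (C : Set V) : Set V :=
  {w | ∃ c ∈ C, (edgeGraph σ S).Reachable c w}

variable {σ}

theorem edgeGraph_adj {S : Set (V × Fin n)} {y z : V} :
    (edgeGraph σ S).Adj y z ↔ y ≠ z ∧ ∃ s, genEdge σ s y ∈ S ∧ genStep σ s y = z := by
  rw [edgeGraph, SimpleGraph.fromRel_adj]
  refine and_congr_right fun _ => ?_
  constructor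
  · rintro (⟨i, hi, h⟩ | ⟨i, hi, h⟩)
    · exact ⟨(i, true), by simpa [genEdge] using hi, by simpa [genStep] using h⟩
    · have h' : (σ i).symm y = z := by rw [← h, Equiv.symm_apply_apply]
      exact ⟨(i, false), by simpa [genEdge, h'] using hi, by simpa [genStep] using h'⟩
  · rintro ⟨⟨i, b⟩, hi, h⟩
    cases b
    · right
      simp only [genEdge, genStep, Bool.false_eq_true, if_false] at hi h
      exact ⟨i, h ▸ hi, by rw [← h, Equiv.apply_symm_apply]⟩
    · left
      exact ⟨i, by simpa [genEdge] using hi, by simpa [genStep] using h⟩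

theorem edgeGraph_mono {S S' : Set (V × Fin n)} (h : S ⊆ S') :
    edgeGraph σ S ≤ edgeGraph σ S' := by
  intro y z
  rw [edgeGraph_adj, edgeGraph_adj]
  rintro ⟨hne, s, hs, hz⟩
  exact ⟨hne, s, h hs, hz⟩

theorem reachable_genStep {S : Set (V × Fin n)} {s : Fin n × Bool} {v : V}
    (h : genEdge σ s v ∈ S) : (edgeGraph σ S).Reachable v (genStep σ s v) := by
  by_cases hv : v = genStep σ s v
  · rw [← hv]
  · exact (edgeGraph_adj.2 ⟨hv, s, h, rfl⟩).reachable

theorem subset_hull (S : Set (V × Fin n)) (C : Set V) : C ⊆ hull σ S C :=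
  fun c hc => ⟨c, hc, SimpleGraph.Reachable.refl c⟩

theorem hull_subset_hull {S S' : Set (V × Fin n)} {C C' : Set V} (hS : S ⊆ S')
    (hC : C ⊆ hull σ S' C') : hull σ S C ⊆ hull σ S' C' := by
  rintro w ⟨c, hc, hcw⟩
  obtain ⟨c', hc', h⟩ := hC hc
  exact ⟨c', hc', h.trans (hcw.mono (edgeGraph_mono hS))⟩

theorem measurableSet_reachable [Countable V] (K : Set (V × Fin n)) (v w : V) :
    MeasurableSet {ω : V × Fin n → Bool | (edgeGraph σ (openEdges ω \ K)).Reachable v w} := by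
  simp only [SimpleGraph.reachable_iff_reflTransGen]
  refine measurableSet_reflTransGen (fun k l => ?_) v w
  simp only [edgeGraph_adj, Set.ofPred_and, Set.ofPred_exists]
  refine (MeasurableSet.const _).inter (MeasurableSet.iUnion fun s => ?_)
  refine MeasurableSet.inter (MeasurableSet.inter ?_ (MeasurableSet.const _)) (MeasurableSet.const _)
  exact measurable_pi_apply (X := fun _ : V × Fin n => Bool) (genEdge σ s k)
    (measurableSet_singleton true)

theorem measurableSet_mem_hull [Countable V] (K : Set (V × Fin n)) (C : Set V) (w : V) :
    MeasurableSet {ω : V × Fin n → Bool | w ∈ hull σ (openEdges ω \ K) C} := by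
  have : {ω : V × Fin n → Bool | w ∈ hull σ (openEdges ω \ K) C} =
      ⋃ c ∈ C, {ω | (edgeGraph σ (openEdges ω \ K)).Reachable c w} := by
    ext ω; simp [hull]
  rw [this]
  exact MeasurableSet.biUnion (Set.to_countable C) fun c _ => measurableSet_reachable K c w

variable (σ) in
/-- The event that at most `m` vertices are joined to `C` by open edges off `K`. -/
def smallHull (m : ℕ) (C : Set V) (K : Set (V × Fin n)) : Set (V × Fin n → Bool) :=
  {ω | ∀ T : Finset V, (T : Set V) ⊆ hull σ (openEdges ω \ K) C → T.card ≤ m}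

theorem measurableSet_smallHull [Countable V] (m : ℕ) (C : Set V) (K : Set (V × Fin n)) :
    MeasurableSet (smallHull σ m C K) := by
  simp only [smallHull, Set.ofPred_forall]
  refine MeasurableSet.iInter fun T => ?_
  have : {ω : V × Fin n → Bool | (T : Set V) ⊆ hull σ (openEdges ω \ K) C → T.card ≤ m} =
      {ω | (T : Set V) ⊆ hull σ (openEdges ω \ K) C}ᶜ ∪ {_ω | T.card ≤ m} := by
    ext ω; simp [imp_iff_not_or]
  rw [this]
  refine MeasurableSet.union (MeasurableSet.compl ?_) (MeasurableSet.const _)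
  have : {ω : V × Fin n → Bool | (T : Set V) ⊆ hull σ (openEdges ω \ K) C} =
      ⋂ w ∈ T, {ω | w ∈ hull σ (openEdges ω \ K) C} := by
    ext ω; simp [Set.subset_def]
  rw [this]
  exact MeasurableSet.biInter (Set.to_countable _) fun w _ => measurableSet_mem_hull K C w

theorem smallHull_iUnion (C : Set V) (K : Set (V × Fin n)) :
    {ω : V × Fin n → Bool | (hull σ (openEdges ω \ K) C).Finite} = ⋃ m, smallHull σ m C K := by
  ext ω
  simp only [Set.mem_ofPred_eq, Set.mem_iUnion]
  constructor
  · intro h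
    refine ⟨h.toFinset.card, fun T hT => Finset.card_le_card fun w hw => ?_⟩
    simpa using hT hw
  · rintro ⟨m, hm⟩
    by_contra hinf
    obtain ⟨T, hT, hcard⟩ := Set.Infinite.exists_subset_card_eq hinf (m + 1)
    have := hm T hT
    omega

theorem smallHull_mono (C : Set V) (K : Set (V × Fin n)) :
    Monotone fun m => smallHull σ m C K :=
  fun _ _ h _ hω T hT => (hω T hT).trans h

variable (σ) in
open Classical in
/-- The oriented boundary edges of the finite set `C`. -/
noncomputable def boundary (C : Finset V) : Finset ((Fin n × Bool) × V) :=
  (Finset.univ ×ˢ C).filter fun q => genStep σ q.1 q.2 ∉ C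

theorem mem_boundary {C : Finset V} {q : (Fin n × Bool) × V} :
    q ∈ boundary σ C ↔ q.2 ∈ C ∧ genStep σ q.1 q.2 ∉ C := by
  simp [boundary]

/-- An edge with one end in `C` and one outside leaves `C` in a single direction. Hence counting
oriented boundary pairs is the same as counting edges, which is what the set `K` of explored edges
does. -/
theorem genEdge_injOn_boundary (C : Finset V) :
    Set.InjOn (fun q : (Fin n × Bool) × V => genEdge σ q.1 q.2) (boundary σ C) := by
  rintro ⟨⟨i, b⟩, v⟩ h ⟨⟨j, c⟩, w⟩ h' heq
  rw [Finset.mem_coe, mem_boundary] at h h'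
  cases b <;> cases c <;> simp only [genEdge, genStep, Bool.false_eq_true, if_false, if_true,
    Prod.mk.injEq] at h h' heq ⊢ <;> obtain ⟨h1, rfl⟩ := heq
  · exact ⟨⟨rfl, trivial⟩, (σ i).symm.injective h1⟩
  · exact absurd h'.1 (h1 ▸ h.2)
  · exact absurd h.1 (h1 ▸ h'.2)
  · exact ⟨⟨rfl, trivial⟩, h1⟩

/-- The exploration bound for the cluster of `C` off the closed edges `K`. -/
theorem real_smallHull_le [Countable V] {p : unitInterval} {h α β : ℝ}
    (hexp : ∀ C : Finset V, h * C.card ≤ (boundary σ C).card) (hα : 0 < α) (hβ : 0 < β)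
    (hαβ : p * α + (1 - p) * β = 1) (hpow : ∀ a b : ℕ, h * a ≤ b → 1 ≤ α ^ a * β ^ b)
    (m : ℕ) (C : Finset V) (K : Finset (V × Fin n)) :
    (bernoulliPercolation (V × Fin n) p).real (smallHull σ m C K) ≤
      α ^ C.card * β ^ K.card := by
  classical
  -- Revealing a boundary edge either enlarges `C` (open) or enlarges `K` (closed). The outer
  -- induction is on the room left before `C` exceeds `m` vertices, the inner one on the number of
  -- boundary edges not yet in `K`.
  obtain ⟨d, hd⟩ : ∃ d, m < C.card + d := ⟨m + 1, by omega⟩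
  induction d generalizing C K with
  | zero =>
    have : smallHull σ m C K = ∅ := by
      refine Set.eq_empty_of_forall_notMem fun ω hω => ?_
      have := hω C (subset_hull _ _)
      omega
    rw [this]
    simp only [measureReal_empty]
    positivity
  | succ d ihd =>
    obtain ⟨r, hr⟩ : ∃ r, ((boundary σ C).filter fun q => genEdge σ q.1 q.2 ∉ K).card = r :=
      ⟨_, rfl⟩
    induction r using Nat.strong_induction_on generalizing K with
    | _ r ihr =>
    by_cases hK : ∃ q ∈ boundary σ C, genEdge σ q.1 q.2 ∉ K
    · obtain ⟨⟨s, v⟩, hq, he⟩ := hK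
      set e := genEdge σ s v with he_def
      have hvC := (mem_boundary.1 hq).1
      have hwC := (mem_boundary.1 hq).2
      set w := genStep σ s v with hw_def
      simp only at hvC hwC he
      have h1 := ihd (insert w C) K (by rw [Finset.card_insert_of_notMem hwC]; omega)
      have h0 := ihr _ ?_ (insert e K) rfl
      · rw [Finset.card_insert_of_notMem hwC] at h1
        rw [Finset.card_insert_of_notMem he] at h0
        have hsub1 : (fun ω => Function.update ω e true) ⁻¹' smallHull σ m C K ⊆
            smallHull σ m (insert w C : Finset V) K := by
          intro ω hω T hT
          refine hω T (hT.trans (hull_subset_hull ?_ ?_))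
          · rintro a ⟨ha, haK⟩
            refine ⟨?_, haK⟩
            by_cases hae : a = e
            · simp [openEdges, hae]
            · simpa [openEdges, hae] using ha
          · intro c hc
            rcases Finset.mem_insert.1 hc with rfl | hc
            · exact ⟨v, hvC, reachable_genStep ⟨by simp [openEdges, he_def], he⟩⟩
            · exact subset_hull _ _ hc
        have hsub0 : (fun ω => Function.update ω e false) ⁻¹' smallHull σ m C K ⊆
            smallHull σ m C (insert e K : Finset _) := by
          intro ω hω T hT
          refine hω T (hT.trans (hull_subset_hull ?_ (subset_hull _ _)))
          rintro a ⟨ha, haK⟩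
          rw [Finset.mem_coe, Finset.mem_insert, not_or] at haK
          exact ⟨by simpa [openEdges, haK.1] using ha, haK.2⟩
        -- The weight `α ^ |C| * β ^ |K|` is a martingale of the exploration: an open edge
        -- multiplies it by `α`, a closed one by `β`, and `p α + (1 - p) β = 1`.
        rw [bernoulliPercolation_real_eq p e (measurableSet_smallHull m C K)]
        have hp0 : (0 : ℝ) ≤ p := p.2.1
        have hp1 : (0 : ℝ) ≤ 1 - p := sub_nonneg.2 p.2.2
        calc _ ≤ (p : ℝ) * (α ^ (C.card + 1) * β ^ K.card) +
              (1 - p) * (α ^ C.card * β ^ (K.card + 1)) :=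
            add_le_add
              (mul_le_mul_of_nonneg_left ((measureReal_mono hsub1).trans h1) hp0)
              (mul_le_mul_of_nonneg_left ((measureReal_mono hsub0).trans h0) hp1)
          _ = (p * α + (1 - p) * β) * (α ^ C.card * β ^ K.card) := by ring
          _ = _ := by rw [hαβ, one_mul]
      · rw [← hr]
        refine Finset.card_lt_card ((Finset.ssubset_iff_of_subset ?_).2 ⟨(s, v), ?_, ?_⟩)
        · intro q hq
          rw [Finset.mem_filter, Finset.mem_insert, not_or] at hq
          exact Finset.mem_filter.2 ⟨hq.1, hq.2.2⟩
        · exact Finset.mem_filter.2 ⟨hq, he⟩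
        · simp [he_def]
    -- The exploration has stopped: the whole boundary lies in `K`, so `|K| ≥ h |C|` and the weight
    -- is at least `1`.
    · push Not at hK
      have hle : (boundary σ C).card ≤ K.card :=
        Finset.card_le_card_of_injOn _ hK (genEdge_injOn_boundary C)
      exact measureReal_le_one.trans
        (hpow _ _ ((hexp C).trans (by exact_mod_cast hle)))

/-- With `q = 1 / (h + 1) < p`, the weights are the likelihood ratios `α = q / p` and `β = (1 - q) /
(1 - p)`, so their mean under `p` is `1`. Moreover `log α + h log β` is `h + 1` times the relative
entropy of Bernoulli(`q`) with respect to Bernoulli(`p`), hence nonnegative. -/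
theorem exists_exploration_weights {p h : ℝ} (hp0 : 0 < p) (hp1 : p < 1) (hh : 0 < h)
    (hp : 1 / (h + 1) < p) : ∃ α β : ℝ, 0 < α ∧ α < 1 ∧ 0 < β ∧ p * α + (1 - p) * β = 1 ∧
      ∀ a b : ℕ, h * a ≤ b → 1 ≤ α ^ a * β ^ b := by
  have hph : 1 < p * (h + 1) := by rwa [div_lt_iff₀ (by linarith)] at hp
  have h1p : 0 < 1 - p := by linarith
  set α := 1 / (p * (h + 1)) with hα_def
  set β := h / ((h + 1) * (1 - p)) with hβ_def
  have hα : 0 < α := by positivity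
  have hβ : 0 < β := by positivity
  have hβ1 : 1 ≤ β := by
    rw [hβ_def, le_div_iff₀ (by positivity)]
    nlinarith
  refine ⟨α, β, hα, ?_, hβ, ?_, fun a b hab => ?_⟩
  · rw [hα_def, div_lt_one (by positivity)]
    exact hph
  · rw [hα_def, hβ_def]
    field_simp
    ring
  · have hlogα := Real.one_sub_inv_le_log_of_pos hα
    have hlogβ := Real.one_sub_inv_le_log_of_pos hβ
    have hsum : 0 ≤ Real.log α + h * Real.log β := by
      have : (1 - α⁻¹) + h * (1 - β⁻¹) = 0 := by
        rw [hα_def, hβ_def]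
        field_simp
        ring
      nlinarith
    have hlog : 0 ≤ Real.log (α ^ a * β ^ b) := by
      rw [Real.log_mul (by positivity) (by positivity), Real.log_pow, Real.log_pow]
      have h1 : h * a * Real.log β ≤ b * Real.log β :=
        mul_le_mul_of_nonneg_right hab (Real.log_nonneg hβ1)
      have h2 := mul_nonneg (Nat.cast_nonneg (α := ℝ) a) hsum
      linarith
    exact (Real.log_nonneg_iff (by positivity)).1 hlog

/-- Under an isoperimetric inequality with constant `h` and for `p > 1 / (h + 1)`, clusters are
infinite with uniformly positive probability. -/
theorem exists_le_real_infinite_hull [Countable V] {p : unitInterval} {h : ℝ}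
    (hexp : ∀ C : Finset V, h * C.card ≤ (boundary σ C).card) (hh : 0 < h) (hp0 : 0 < p)
    (hp1 : p < 1) (hp : 1 / (h + 1) < (p : ℝ)) :
    ∃ c : ℝ, 0 < c ∧ ∀ v, c ≤ (bernoulliPercolation (V × Fin n) p).real
      {ω | (hull σ (openEdges ω \ ∅) {v}).Infinite} := by
  obtain ⟨α, β, hα, hα1, hβ, hαβ, hpow⟩ :=
    exists_exploration_weights (p := p) (by exact_mod_cast hp0) (by exact_mod_cast hp1) hh hp
  refine ⟨1 - α, by linarith, fun v => ?_⟩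
  have hU := smallHull_iUnion (σ := σ) {v} ∅
  have hmeas : MeasurableSet {ω : V × Fin n → Bool | (hull σ (openEdges ω \ ∅) {v}).Finite} := by
    rw [hU]
    exact MeasurableSet.iUnion fun m => measurableSet_smallHull m _ _
  have hfin : (bernoulliPercolation (V × Fin n) p).real
      -- The exploration starts at `C = {v}`, `K = ∅`, where the weight is `α`, whatever `m` and `v`
      -- are.
      {ω | (hull σ (openEdges ω \ ∅) {v}).Finite} ≤ α := by
    rw [measureReal_def, hU, (smallHull_mono _ _).measure_iUnion]
    refine ENNReal.toReal_le_of_le_ofReal hα.le (iSup_le fun m => ?_)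
    refine (ENNReal.le_ofReal_iff_toReal_le (measure_ne_top _ _) hα.le).2 ?_
    have := real_smallHull_le hexp hα hβ hαβ hpow m {v} ∅
    simpa [measureReal_def] using this
  have hcompl := probReal_compl_eq_one_sub (μ := bernoulliPercolation (V × Fin n) p) hmeas
  have : {ω : V × Fin n → Bool | (hull σ (openEdges ω \ ∅) {v}).Infinite} =
      {ω | (hull σ (openEdges ω \ ∅) {v}).Finite}ᶜ := rfl
  rw [this, hcompl]
  linarith

end PermGraph

/-! ### Decay of the two-point function, and the isoperimetric inequality from the norm bound. -/

section TwoPoint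

open Filter Topology

variable {V : Type*} {n : ℕ} (σ : Fin n → Equiv.Perm V)

/-- The adjacency operator of the multigraph generated by `σ`, on functions `V → ℕ`. -/
def genOp (f : V → ℕ) (v : V) : ℕ := ∑ s : Fin n × Bool, f (genStep σ s v)

/-- The adjacency operator has norm at most `t` on finitely supported `ℕ`-valued functions. -/
def AdjBound (t : ℝ) : Prop :=
  ∀ f : V → ℕ, f.support.Finite →
    ∑' v, (genOp σ f v : ENNReal) ^ 2 ≤ ENNReal.ofReal t ^ 2 * ∑' v, (f v : ENNReal) ^ 2

open Classical in
/-- The number of paths of length `k` from `v` to `w`. -/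
noncomputable def pathCount (w : V) : ℕ → V → ℕ
  | 0 => fun v => if v = w then 1 else 0
  | k + 1 => genOp σ (pathCount w k)

/-- `w` is reached from `v` by a self-avoiding path of fewer than `K` steps avoiding `U`. -/
def AvoidReach (S : Set (V × Fin n)) (w : V) : ℕ → Set V → V → Prop
  | 0, _, _ => False
  | K + 1, U, v => v ∉ U ∧
      (v = w ∨ ∃ s, genEdge σ s v ∈ S ∧ AvoidReach S w K (insert v U) (genStep σ s v))

variable {σ}

theorem genStep_injective (s : Fin n × Bool) : Function.Injective (genStep σ s) := by
  intro v w h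
  unfold genStep at h
  split_ifs at h
  · exact (σ s.1).injective h
  · exact (σ s.1).symm.injective h

theorem finite_support_genOp {f : V → ℕ} (hf : f.support.Finite) :
    (genOp σ f).support.Finite := by
  refine (Set.finite_iUnion fun s => hf.preimage (genStep_injective (σ := σ) s).injOn).subset ?_
  intro v hv
  rw [Function.mem_support, genOp, Ne, Finset.sum_eq_zero_iff] at hv
  push Not at hv
  obtain ⟨s, -, hs⟩ := hv
  exact Set.mem_iUnion.2 ⟨s, hs⟩

theorem finite_support_pathCount (w : V) (k : ℕ) : (pathCount σ w k).support.Finite := by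
  induction k with
  | zero =>
    refine (Set.finite_singleton w).subset fun v hv => ?_
    by_contra h
    exact hv (by simpa [pathCount] using h)
  | succ k ih => exact finite_support_genOp ih

/-- The path counts are the `k`-th iterate of the adjacency operator on the point mass at `w`; a
single value is at most the `ℓ²` norm. -/
theorem pathCount_le {t : ℝ} (ht : 0 ≤ t) (hσ : AdjBound σ t) (w : V) (k : ℕ) (v : V) :
    (pathCount σ w k v : ℝ) ≤ t ^ k := by
  have h : ∑' v, (pathCount σ w k v : ENNReal) ^ 2 ≤ (ENNReal.ofReal t ^ k) ^ 2 := by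
    induction k with
    | zero =>
      rw [tsum_eq_single w fun v hv => by simp [pathCount, hv]]
      simp [pathCount]
    | succ k ih =>
      refine (hσ _ (finite_support_pathCount w k)).trans ?_
      rw [pow_succ' (ENNReal.ofReal t) k, mul_pow]
      exact mul_le_mul_right ih _
  have h1 := (ENNReal.le_tsum v).trans h
  rw [ENNReal.pow_le_pow_left_iff two_ne_zero, ← ENNReal.ofReal_pow ht,
    ← ENNReal.ofReal_natCast] at h1
  exact (ENNReal.ofReal_le_ofReal_iff (by positivity)).1 h1

theorem AvoidReach.notMem {S : Set (V × Fin n)} {w v : V} {K : ℕ} {U : Set V}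
    (h : AvoidReach σ S w K U v) : v ∉ U := by
  cases K with
  | zero => exact h.elim
  | succ K => exact h.1

theorem AvoidReach.succ {S : Set (V × Fin n)} {w v : V} {K : ℕ} {U : Set V}
    (h : AvoidReach σ S w K U v) : AvoidReach σ S w (K + 1) U v := by
  induction K generalizing U v with
  | zero => exact h.elim
  | succ K ih =>
    obtain ⟨hv, h | ⟨s, hs, h⟩⟩ := h
    · exact ⟨hv, Or.inl h⟩
    · exact ⟨hv, Or.inr ⟨s, hs, ih h⟩⟩

theorem genEdge_endpoints (s : Fin n × Bool) (v : V) :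
    ((genEdge σ s v).1 = v ∨ (genEdge σ s v).1 = genStep σ s v) ∧
      (σ (genEdge σ s v).2 (genEdge σ s v).1 = v ∨
        σ (genEdge σ s v).2 (genEdge σ s v).1 = genStep σ s v) ∧
      ((genEdge σ s v).1 = v ∨ σ (genEdge σ s v).2 (genEdge σ s v).1 = v) := by
  rcases s with ⟨i, b⟩
  cases b <;> simp [genEdge, genStep]

/-- A path avoiding `U` never uses an edge with an end in `U`. This makes the first edge of a
self-avoiding path independent of the existence of the rest, which avoids the starting vertex. -/
theorem AvoidReach.congr {S S' : Set (V × Fin n)} {w v : V} {K : ℕ} {U : Set V} {e : V × Fin n}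
    (he : e.1 ∈ U ∨ σ e.2 e.1 ∈ U) (hS : ∀ a ≠ e, a ∈ S → a ∈ S')
    (h : AvoidReach σ S w K U v) : AvoidReach σ S' w K U v := by
  induction K generalizing U v with
  | zero => exact h.elim
  | succ K ih =>
    obtain ⟨hv, h | ⟨s, hs, h⟩⟩ := h
    · exact ⟨hv, Or.inl h⟩
    · refine ⟨hv, Or.inr ⟨s, hS _ ?_ hs, ih ?_ h⟩⟩
      · have hv' : genStep σ s v ∉ U := fun hU => h.notMem (Set.mem_insert_of_mem _ hU)
        rintro rfl
        obtain ⟨h1, h2, -⟩ := genEdge_endpoints (σ := σ) s v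
        rcases he with he | he
        · rcases h1 with h1 | h1 <;> rw [h1] at he <;> contradiction
        · rcases h2 with h2 | h2 <;> rw [h2] at he <;> contradiction
      · exact he.imp (Set.mem_insert_of_mem _) (Set.mem_insert_of_mem _)

theorem exists_avoidReach {S : Set (V × Fin n)} {v w : V} (h : (edgeGraph σ S).Reachable v w) :
    ∃ K, AvoidReach σ S w K ∅ v := by
  obtain ⟨q, hq⟩ := h.exists_isPath
  have key : ∀ U : Set V, (∀ u ∈ q.support, u ∉ U) → AvoidReach σ S w (q.length + 1) U v := by
    clear h
    induction q with
    | nil => exact fun U hU => ⟨hU _ (by simp), Or.inl rfl⟩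
    | cons hadj q ih =>
      rw [SimpleGraph.Walk.cons_isPath_iff] at hq
      intro U hU
      obtain ⟨-, s, hs, rfl⟩ := edgeGraph_adj.1 hadj
      refine ⟨hU _ (by simp), Or.inr ⟨s, hs, ih hq.1 _ fun u hu huU => ?_⟩⟩
      rcases huU with rfl | huU
      · exact hq.2 hu
      · exact hU u (by simp [hu]) huU
  exact ⟨_, key ∅ fun _ _ h => h⟩

theorem measurableSet_mem_openEdges {E : Type*} (e : E) :
    MeasurableSet {ω : E → Bool | e ∈ openEdges ω} :=
  measurable_pi_apply (X := fun _ : E => Bool) e (measurableSet_singleton true)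

theorem measurableSet_avoidReach (w : V) (K : ℕ) (U : Set V) (v : V) :
    MeasurableSet {ω : V × Fin n → Bool | AvoidReach σ (openEdges ω) w K U v} := by
  induction K generalizing U v with
  | zero => exact MeasurableSet.const False
  | succ K ih =>
    simp only [AvoidReach, Set.ofPred_and, Set.ofPred_or, Set.ofPred_exists]
    exact (MeasurableSet.const _).inter ((MeasurableSet.const _).union
      (MeasurableSet.iUnion fun s => (measurableSet_mem_openEdges _).inter (ih _ _)))

/-- Union bound over the first step: it costs a factor `p`, and the sum over its directions is the
recursion defining `pathCount`. -/
theorem real_avoidReach_le (p : unitInterval) (w : V) (K : ℕ) (U : Set V) (v : V) :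
    (bernoulliPercolation (V × Fin n) p).real {ω | AvoidReach σ (openEdges ω) w K U v} ≤
      ∑ k ∈ Finset.range K, (p : ℝ) ^ k * pathCount σ w k v := by
  induction K generalizing U v with
  | zero => simp [AvoidReach]
  | succ K ih =>
    have hsub : {ω : V × Fin n → Bool | AvoidReach σ (openEdges ω) w (K + 1) U v} ⊆
        {_ω | v = w} ∪ ⋃ s : Fin n × Bool, ({ω | ω (genEdge σ s v) = true} ∩
          {ω | AvoidReach σ (openEdges ω) w K (insert v U) (genStep σ s v)}) := by
      rintro ω ⟨-, h | ⟨s, hs, h⟩⟩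
      · exact Or.inl h
      · exact Or.inr (Set.mem_iUnion.2 ⟨s, hs, h⟩)
    have h0 : (bernoulliPercolation (V × Fin n) p).real {_ω | v = w} ≤ pathCount σ w 0 v := by
      by_cases hvw : v = w <;> simp [pathCount, hvw]
    have h1 : ∀ s : Fin n × Bool, (bernoulliPercolation (V × Fin n) p).real
        ({ω | ω (genEdge σ s v) = true} ∩
          {ω | AvoidReach σ (openEdges ω) w K (insert v U) (genStep σ s v)}) ≤
        p * ∑ k ∈ Finset.range K, (p : ℝ) ^ k * pathCount σ w k (genStep σ s v) := by
      intro s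
      rw [bernoulliPercolation_real_inter_eval p _ true (measurableSet_avoidReach _ _ _ _)]
      · simpa using mul_le_mul_of_nonneg_left (ih (insert v U) (genStep σ s v)) p.2.1
      · intro ω ω' hω h
        refine AvoidReach.congr (e := genEdge σ s v) ?_ (fun a ha hS => ?_) h
        · exact (genEdge_endpoints s v).2.2.imp (fun h => by rw [h]; exact Set.mem_insert _ _)
            (fun h => by rw [h]; exact Set.mem_insert _ _)
        · exact (hω a ha).symm.trans hS
    calc _ ≤ _ := measureReal_mono hsub
      _ ≤ _ := measureReal_union_le _ _
      _ ≤ pathCount σ w 0 v + ∑ s : Fin n × Bool,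
          p * ∑ k ∈ Finset.range K, (p : ℝ) ^ k * pathCount σ w k (genStep σ s v) :=
        add_le_add h0 ((measureReal_iUnion_fintype_le _).trans (Finset.sum_le_sum fun s _ => h1 s))
      _ = _ := by
        rw [Finset.sum_range_succ', add_comm]
        congr 1
        · simp only [Finset.mul_sum]
          rw [Finset.sum_comm]
          refine Finset.sum_congr rfl fun k _ => ?_
          simp only [pathCount, genOp, Nat.cast_sum, Finset.mul_sum]
          refine Finset.sum_congr rfl fun s _ => ?_
          ring
        · simp

/-- Below the inverse of the norm of the adjacency operator the two-point function vanishes at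
infinity. -/
theorem tendsto_real_reachable {p : unitInterval} {t : ℝ} (ht : 0 ≤ t)
    (hσ : AdjBound σ t) (hpt : p * t < 1) (w : V) :
    Tendsto (fun v => (bernoulliPercolation (V × Fin n) p).real
      {ω | (edgeGraph σ (openEdges ω)).Reachable v w}) cofinite (𝓝 0) := by
  have hp0 : (0 : ℝ) ≤ p := p.2.1
  have hbound : ∀ v k, (p : ℝ) ^ k * pathCount σ w k v ≤ (p * t) ^ k := fun v k => by
    rw [mul_pow]
    exact mul_le_mul_of_nonneg_left (pathCount_le ht hσ w k v) (by positivity)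
  have hsum : Summable fun k => ((p : ℝ) * t) ^ k :=
    summable_geometric_of_lt_one (by positivity) hpt
  have hsum' : ∀ v, Summable fun k => (p : ℝ) ^ k * pathCount σ w k v := fun v =>
    Summable.of_nonneg_of_le (fun k => by positivity) (hbound v) hsum
  have hle : ∀ v, (bernoulliPercolation (V × Fin n) p).real
      {ω | (edgeGraph σ (openEdges ω)).Reachable v w} ≤ ∑' k, (p : ℝ) ^ k * pathCount σ w k v := by
    intro v
    have hsub : {ω : V × Fin n → Bool | (edgeGraph σ (openEdges ω)).Reachable v w} ⊆
        ⋃ K, {ω | AvoidReach σ (openEdges ω) w K ∅ v} :=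
      fun ω h => Set.mem_iUnion.2 (exists_avoidReach h)
    have hmono : Monotone fun K =>
        {ω : V × Fin n → Bool | AvoidReach σ (openEdges ω) w K ∅ v} :=
      monotone_nat_of_le_succ fun K ω h => AvoidReach.succ h
    have h0 : 0 ≤ ∑' k, (p : ℝ) ^ k * pathCount σ w k v := tsum_nonneg fun k => by positivity
    refine (measureReal_mono hsub).trans ?_
    rw [measureReal_def, hmono.measure_iUnion]
    refine ENNReal.toReal_le_of_le_ofReal h0 (iSup_le fun K => ?_)
    refine (ENNReal.le_ofReal_iff_toReal_le (measure_ne_top _ _) h0).2 ?_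
    exact (real_avoidReach_le p w K ∅ v).trans
      ((hsum' v).sum_le_tsum _ fun k _ => by positivity)
  -- Dominated convergence: for fixed `k` the term vanishes outside finitely many `v`, and all terms
  -- are below the geometric sequence `(p t) ^ k`.
  have hlim : Tendsto (fun v => ∑' k, (p : ℝ) ^ k * pathCount σ w k v) cofinite (𝓝 0) := by
    have := tendsto_tsum_of_dominated_convergence (𝓕 := cofinite)
      (f := fun v k => (p : ℝ) ^ k * pathCount σ w k v) (g := fun _ => 0) hsum ?_ ?_
    · simpa using this
    · intro k
      refine tendsto_const_nhds.congr' ?_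
      filter_upwards [(finite_support_pathCount (σ := σ) w k).compl_mem_cofinite] with v hv
      have : pathCount σ w k v = 0 := by simpa using hv
      simp [this]
    · refine Eventually.of_forall fun v k => ?_
      rw [Real.norm_of_nonneg (by positivity)]
      exact hbound v k
  exact squeeze_zero (fun _ => measureReal_nonneg) hle hlim

/-- The isoperimetric inequality with constant `2n - t`. -/
theorem AdjBound.boundary_le {t : ℝ} (ht : 0 ≤ t) (hσ : AdjBound σ t) (C : Finset V) :
    (2 * n - t) * C.card ≤ (boundary σ C).card := by
  classical
  let f : V → ℕ := fun v => if v ∈ C then 1 else 0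
  have hf : f.support.Finite := C.finite_toSet.subset fun v hv => by
    by_contra h
    exact hv (by simpa [f] using h)
  have h1 : ∑' v, (f v : ENNReal) ^ 2 = C.card := by
    rw [tsum_eq_sum (s := C) fun v hv => by simp [f, hv]]
    rw [Finset.sum_congr rfl fun v hv => show (f v : ENNReal) ^ 2 = 1 by simp [f, hv]]
    simp
  have h2 : (∑ v ∈ C, (genOp σ f v : ℝ) ^ 2) ≤ t ^ 2 * C.card := by
    have h := (ENNReal.sum_le_tsum C).trans (hσ f hf)
    rw [h1, ← ENNReal.ofReal_pow ht, ← ENNReal.ofReal_natCast,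
      ← ENNReal.ofReal_mul (by positivity)] at h
    refine (ENNReal.ofReal_le_ofReal_iff (by positivity)).1 (le_trans (le_of_eq ?_) h)
    rw [ENNReal.ofReal_sum_of_nonneg fun _ _ => by positivity]
    refine Finset.sum_congr rfl fun v _ => ?_
    rw [ENNReal.ofReal_pow (by positivity), ENNReal.ofReal_natCast]
  -- Cauchy–Schwarz on `C`. The left side counts the oriented steps that stay in `C`; those that
  -- leave it make up the rest of the `2n |C|` steps.
  have h3 : (∑ v ∈ C, (genOp σ f v : ℝ)) ≤ t * C.card := by
    refine abs_le_of_sq_le_sq' ?_ (by positivity) |>.2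
    calc (∑ v ∈ C, (genOp σ f v : ℝ)) ^ 2 ≤ C.card * ∑ v ∈ C, (genOp σ f v : ℝ) ^ 2 :=
          sq_sum_le_card_mul_sum_sq
      _ ≤ C.card * (t ^ 2 * C.card) := by gcongr
      _ = _ := by ring
  have h4 : (∑ v ∈ C, genOp σ f v) + (boundary σ C).card = 2 * n * C.card := by
    have hin : ∑ v ∈ C, genOp σ f v =
        ((Finset.univ ×ˢ C).filter fun q : (Fin n × Bool) × V => genStep σ q.1 q.2 ∈ C).card := by
      rw [Finset.card_filter, Finset.sum_product_right]
      rfl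
    rw [hin, boundary, Finset.card_filter_add_card_filter_not, Finset.card_product]
    simp [mul_comm]
  have h5 : (∑ v ∈ C, (genOp σ f v : ℝ)) + (boundary σ C).card = 2 * n * C.card := by
    exact_mod_cast h4
  linarith

end TwoPoint

open Filter Topology

/-! ### Asymptotic independence: from cylinders to all events. -/

section Mixing

variable {E : Type*}

/-- The configurations which agree with `b` on `S`. -/
def basicCylinder (S : Finset E) (b : E → Bool) : Set (E → Bool) := {ω | ∀ e ∈ S, ω e = b e}

theorem measurableSet_basicCylinder (S : Finset E) (b : E → Bool) :
    MeasurableSet (basicCylinder S b) := by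
  have : basicCylinder S b = Set.pi S fun e => {b e} := by
    ext ω; simp [basicCylinder, Set.mem_pi]
  rw [this]
  exact MeasurableSet.pi S.countable_toSet fun _ _ => measurableSet_singleton _

theorem isPiSystem_basicCylinder :
    IsPiSystem (Set.range fun q : Finset E × (E → Bool) => basicCylinder q.1 q.2) := by
  classical
  rintro _ ⟨⟨S, b⟩, rfl⟩ _ ⟨⟨S', b'⟩, rfl⟩ ⟨η, h, h'⟩
  refine ⟨(S ∪ S', η), ?_⟩
  ext ω
  simp only [basicCylinder, Finset.mem_union, Set.mem_inter_iff, Set.mem_ofPred_eq] at h h' ⊢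
  constructor
  · exact fun hω => ⟨fun e he => (hω e (Or.inl he)).trans (h e he),
      fun e he => (hω e (Or.inr he)).trans (h' e he)⟩
  · rintro ⟨h1, h2⟩ e (he | he)
    · exact (h1 e he).trans (h e he).symm
    · exact (h2 e he).trans (h' e he).symm

theorem generateFrom_basicCylinder :
    (MeasurableSpace.pi : MeasurableSpace (E → Bool)) = MeasurableSpace.generateFrom
      (Set.range fun q : Finset E × (E → Bool) => basicCylinder q.1 q.2) := by
  apply le_antisymm
  · refine iSup_le fun e => Measurable.comap_le ?_
    refine @measurable_to_countable' _ _ _ _ (_) _ fun b => ?_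
    refine MeasurableSpace.measurableSet_generateFrom ⟨({e}, fun _ => b), ?_⟩
    ext ω
    simp [basicCylinder]
  · refine MeasurableSpace.generateFrom_le ?_
    rintro _ ⟨q, rfl⟩
    exact measurableSet_basicCylinder _ _

/-- An event which does not depend on the coordinates in `S` is independent of the cylinders
over `S`. -/
theorem real_basicCylinder_inter (p : unitInterval) (S : Finset E) (b : E → Bool)
    {A : Set (E → Bool)} (hA : MeasurableSet A)
    (hinv : ∀ ω ω', (∀ a ∉ S, ω a = ω' a) → ω ∈ A → ω' ∈ A) :
    (bernoulliPercolation E p).real (basicCylinder S b ∩ A) =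
      (bernoulliPercolation E p).real (basicCylinder S b) *
        (bernoulliPercolation E p).real A := by
  classical
  have key : ∀ A : Set (E → Bool), MeasurableSet A →
      (∀ ω ω', (∀ a ∉ S, ω a = ω' a) → ω ∈ A → ω' ∈ A) →
      (bernoulliPercolation E p).real (basicCylinder S b ∩ A) =
        (∏ e ∈ S, if b e then (p : ℝ) else 1 - p) * (bernoulliPercolation E p).real A := by
    clear hA hinv A
    intro A hA
    induction S using Finset.induction_on with
    | empty => intro _; simp [basicCylinder]
    | insert e S he ih =>
      intro hinv
      have hcyl : basicCylinder (insert e S) b ∩ A =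
          {ω | ω e = b e} ∩ (basicCylinder S b ∩ A) := by
        ext ω
        simp [basicCylinder, and_assoc]
      rw [hcyl, bernoulliPercolation_real_inter_eval p e (b e)
        ((measurableSet_basicCylinder S b).inter hA), ih, Finset.prod_insert he, mul_assoc]
      · exact fun ω ω' h => hinv ω ω' fun a ha =>
          h a fun haS => ha (Finset.mem_insert_of_mem haS)
      · rintro ω ω' h ⟨h1, h2⟩
        refine ⟨fun a ha => ?_, hinv ω ω' (fun a ha => h a ?_) h2⟩
        · rw [← h1 a ha, h a (by rintro rfl; exact he ha)]
        · rintro rfl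
          exact ha (Finset.mem_insert_self _ _)
  -- The case of the full event identifies the product of weights as the probability of the
  -- cylinder.
  have h1 := key Set.univ MeasurableSet.univ fun _ _ _ h => h
  rw [Set.inter_univ, probReal_univ, mul_one] at h1
  rw [key A hA hinv, h1]

theorem hasSum_real_iUnion {Ω : Type*} [MeasurableSpace Ω] {P : Measure Ω} [IsFiniteMeasure P]
    {f : ℕ → Set Ω} (hd : Pairwise (Function.onFun Disjoint f)) (hf : ∀ i, MeasurableSet (f i)) :
    HasSum (fun i => P.real (f i)) (P.real (⋃ i, f i)) := by
  have h := measure_iUnion (μ := P) hd hf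
  rw [measureReal_def, h, ENNReal.tsum_toReal_eq fun i => measure_ne_top _ _]
  exact ENNReal.hasSum_toReal (h ▸ measure_ne_top _ _)

/-- A family of events which is asymptotically independent of all cylinders is asymptotically
independent of all events. -/
theorem tendsto_real_inter_sub {ι : Type*} {l : Filter ι} (P : Measure (E → Bool))
    [IsProbabilityMeasure P] {A : ι → Set (E → Bool)} (hA : ∀ z, MeasurableSet (A z))
    (hcyl : ∀ S b, Tendsto (fun z => P.real (basicCylinder S b ∩ A z) -
      P.real (basicCylinder S b) * P.real (A z)) l (𝓝 0))
    {B : Set (E → Bool)} (hB : MeasurableSet B) :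
    Tendsto (fun z => P.real (B ∩ A z) - P.real B * P.real (A z)) l (𝓝 0) := by
  induction B, hB using MeasurableSpace.induction_on_inter generateFrom_basicCylinder
    isPiSystem_basicCylinder with
  | empty => simpa using tendsto_const_nhds
  | basic t ht =>
    obtain ⟨q, rfl⟩ := ht
    exact hcyl _ _
  | compl t ht ih =>
    have := ih.neg
    rw [neg_zero] at this
    refine this.congr fun z => ?_
    have h1 : P.real (tᶜ ∩ A z) = P.real (A z) - P.real (t ∩ A z) := by
      have := measureReal_inter_add_sdiff (μ := P) (s := A z) ht
      rw [Set.sdiff_eq, Set.inter_comm (A z), Set.inter_comm (A z)] at this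
      linarith
    rw [h1, probReal_compl_eq_one_sub ht]
    ring
  | iUnion f hd hf ih =>
    have hsum : ∀ z, HasSum (fun i => P.real (f i ∩ A z)) (P.real ((⋃ i, f i) ∩ A z)) := by
      intro z
      rw [Set.iUnion_inter]
      refine hasSum_real_iUnion
        (fun i j hij => (hd hij).mono Set.inter_subset_left Set.inter_subset_left)
        fun i => (hf i).inter (hA z)
    have hsum0 : HasSum (fun i => P.real (f i)) (P.real (⋃ i, f i)) :=
      hasSum_real_iUnion hd hf
    -- The `i`-th term is bounded by `P.real (f i)`, which is summable and does not depend on `z`.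
    have := tendsto_tsum_of_dominated_convergence (𝓕 := l)
      (f := fun z i => P.real (f i ∩ A z) - P.real (f i) * P.real (A z)) (g := fun _ => 0)
      hsum0.summable ih (Eventually.of_forall fun z i => ?_)
    · simp only [tsum_zero] at this
      exact this.congr fun z => ((hsum z).sub (hsum0.mul_right _)).tsum_eq
    · have h1 : P.real (f i ∩ A z) ≤ P.real (f i) := measureReal_mono Set.inter_subset_left
      have h2 : P.real (f i) * P.real (A z) ≤ P.real (f i) :=
        mul_le_of_le_one_right measureReal_nonneg measureReal_le_one
      have h3 : 0 ≤ P.real (f i ∩ A z) := measureReal_nonneg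
      have h4 : 0 ≤ P.real (f i) * P.real (A z) := mul_nonneg measureReal_nonneg measureReal_nonneg
      rw [Real.norm_eq_abs, abs_le]
      constructor <;> linarith

end Mixing

/-! ### Infinitely many infinite clusters on one graph. -/

section Clusters

variable {V : Type*} {n : ℕ} {σ : Fin n → Equiv.Perm V}

theorem reachable_sdiff {O S : Set (V × Fin n)} {z w : V}
    (hz : ∀ e ∈ S, ¬ (edgeGraph σ O).Reachable z e.1 ∧
      ¬ (edgeGraph σ O).Reachable z (σ e.2 e.1))
    (h : (edgeGraph σ O).Reachable z w) : (edgeGraph σ (O \ S)).Reachable z w := by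
  rw [SimpleGraph.reachable_iff_reflTransGen] at h
  induction h with
  | refl => exact SimpleGraph.Reachable.refl z
  | tail hw hadj ih =>
    obtain ⟨-, s, hs, rfl⟩ := edgeGraph_adj.1 hadj
    rw [← SimpleGraph.reachable_iff_reflTransGen] at hw
    refine ih.trans (reachable_genStep ⟨hs, fun hS => ?_⟩)
    rcases (genEdge_endpoints (σ := σ) s _).2.2 with h | h
    · exact (hz _ hS).1 (by rwa [h])
    · exact (hz _ hS).2 (by rwa [h])

variable (σ) in
/-- The event that the cluster of `z` off `K` is infinite. -/
def infiniteHull (K : Set (V × Fin n)) (z : V) : Set (V × Fin n → Bool) :=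
  {ω | (hull σ (openEdges ω \ K) {z}).Infinite}

theorem measurableSet_infiniteHull [Countable V] (K : Set (V × Fin n)) (z : V) :
    MeasurableSet (infiniteHull σ K z) := by
  have : infiniteHull σ K z = {ω | (hull σ (openEdges ω \ K) {z}).Finite}ᶜ := rfl
  rw [this, smallHull_iUnion]
  exact (MeasurableSet.iUnion fun m => measurableSet_smallHull m _ _).compl

variable (σ) in
/-- The event that `v` and `w` are in the same cluster. -/
def connectedEvent (v w : V) : Set (V × Fin n → Bool) :=
  {ω | (edgeGraph σ (openEdges ω)).Reachable v w}

theorem measurableSet_connectedEvent [Countable V] (v w : V) :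
    MeasurableSet (connectedEvent σ v w) := by
  simpa [connectedEvent] using measurableSet_reachable (σ := σ) ∅ v w

theorem infiniteHull_sdiff_subset (S : Finset (V × Fin n)) (z : V) :
    infiniteHull σ ∅ z \ infiniteHull σ S z ⊆
      ⋃ e ∈ S, (connectedEvent σ z e.1 ∪ connectedEvent σ z (σ e.2 e.1)) := by
  rintro ω ⟨h1, h2⟩
  by_contra h
  simp only [Set.mem_iUnion, not_exists, Set.mem_union, not_or] at h
  refine h2 (h1.mono ?_)
  rintro w ⟨c, rfl, hw⟩
  rw [Set.sdiff_empty] at hw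
  exact ⟨c, rfl, reachable_sdiff (fun e he => h e he) hw⟩

/-- For a cylinder over `S`, deleting the edges of `S` makes the infinite-cluster event exactly
independent of it. The deletion matters only if `z` is connected to an end of an edge of `S`, which
has vanishing probability. -/
theorem tendsto_real_infiniteHull_inter_sub [Countable V] {p : unitInterval}
    (hτ : ∀ w, Tendsto (fun v => (bernoulliPercolation (V × Fin n) p).real (connectedEvent σ v w))
      cofinite (𝓝 0)) {B : Set (V × Fin n → Bool)} (hB : MeasurableSet B) :
    Tendsto (fun z => (bernoulliPercolation (V × Fin n) p).real (B ∩ infiniteHull σ ∅ z) -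
      (bernoulliPercolation (V × Fin n) p).real B *
        (bernoulliPercolation (V × Fin n) p).real (infiniteHull σ ∅ z)) cofinite (𝓝 0) := by
  set P := bernoulliPercolation (V × Fin n) p
  refine tendsto_real_inter_sub P (fun z => measurableSet_infiniteHull ∅ z) (fun S b => ?_) hB
  have hlim : Tendsto (fun z => ∑ e ∈ S, (P.real (connectedEvent σ z e.1) +
      P.real (connectedEvent σ z (σ e.2 e.1)))) cofinite (𝓝 0) := by
    have h : Tendsto (fun z => ∑ e ∈ S, (P.real (connectedEvent σ z e.1) +
        P.real (connectedEvent σ z (σ e.2 e.1)))) cofinite (𝓝 (∑ e ∈ S, (0 + 0))) :=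
      tendsto_finsetSum S fun e _ => (hτ e.1).add (hτ (σ e.2 e.1))
    simpa using h
  refine squeeze_zero_norm (fun z => ?_) hlim
  set A := infiniteHull σ ∅ z
  set A' := infiniteHull σ S z
  set Q := basicCylinder S b
  have hsub : A' ⊆ A := by
    intro ω hω
    refine hω.mono (hull_subset_hull ?_ (subset_hull _ _))
    exact Set.sdiff_subset_sdiff_right (Set.empty_subset _)
  have hδ : P.real (A \ A') ≤ ∑ e ∈ S, (P.real (connectedEvent σ z e.1) +
      P.real (connectedEvent σ z (σ e.2 e.1))) :=
    (measureReal_mono (infiniteHull_sdiff_subset S z) (measure_ne_top _ _)).trans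
      ((measureReal_biUnion_finset_le _ _).trans
        (Finset.sum_le_sum fun e _ => measureReal_union_le _ _))
  have hind : P.real (Q ∩ A') = P.real Q * P.real A' := by
    refine real_basicCylinder_inter p S b (measurableSet_infiniteHull _ _) fun ω ω' h hω => ?_
    refine hω.mono (hull_subset_hull ?_ (subset_hull _ _))
    rintro e ⟨he, heS⟩
    exact ⟨(h e heS).symm.trans he, heS⟩
  have h1 : P.real A' ≤ P.real A := measureReal_mono hsub
  have h2 : P.real A ≤ P.real A' + P.real (A \ A') := by
    refine (measureReal_mono ?_).trans (measureReal_union_le _ _)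
    intro ω hω
    by_cases h : ω ∈ A'
    · exact Or.inl h
    · exact Or.inr ⟨hω, h⟩
  have h3 : P.real (Q ∩ A') ≤ P.real (Q ∩ A) :=
    measureReal_mono (Set.inter_subset_inter_right _ hsub)
  have h4 : P.real (Q ∩ A) ≤ P.real (Q ∩ A') + P.real (A \ A') := by
    refine (measureReal_mono ?_).trans (measureReal_union_le _ _)
    rintro ω ⟨hQ, hω⟩
    by_cases h : ω ∈ A'
    · exact Or.inl ⟨hQ, h⟩
    · exact Or.inr ⟨hω, h⟩
  have h5 : P.real Q * (P.real A - P.real A') ≤ P.real A - P.real A' :=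
    mul_le_of_le_one_left (by linarith) measureReal_le_one
  have h6 : 0 ≤ P.real Q * (P.real A - P.real A') :=
    mul_nonneg measureReal_nonneg (by linarith)
  rw [Real.norm_eq_abs, abs_le]
  constructor <;> nlinarith

variable (σ) in
/-- The event that all infinite clusters meet `F`. -/
def infiniteClustersMeet (F : Finset V) : Set (V × Fin n → Bool) :=
  {ω | ∀ z, ω ∈ infiniteHull σ ∅ z → ∃ f ∈ F, ω ∈ connectedEvent σ z f}

theorem measurableSet_infiniteClustersMeet [Countable V] (F : Finset V) :
    MeasurableSet (infiniteClustersMeet σ F) := by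
  have : infiniteClustersMeet σ F =
      ⋂ z, ((infiniteHull σ ∅ z)ᶜ ∪ ⋃ f ∈ F, connectedEvent σ z f) := by
    ext ω
    simp [infiniteClustersMeet, imp_iff_not_or]
  rw [this]
  exact MeasurableSet.iInter fun z => (measurableSet_infiniteHull _ _).compl.union
    (MeasurableSet.biUnion F.countable_toSet fun f _ => measurableSet_connectedEvent z f)

/-- Decay of connections to `F` and asymptotic independence force `P(B) P(A_z) → 0`, against `P(A_z)
≥ c`. -/
theorem real_infiniteClustersMeet_eq_zero [Countable V] [Infinite V] {p : unitInterval} {c : ℝ}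
    (hτ : ∀ w, Tendsto (fun v => (bernoulliPercolation (V × Fin n) p).real (connectedEvent σ v w))
      cofinite (𝓝 0)) (hc : 0 < c)
    (hinf : ∀ z, c ≤ (bernoulliPercolation (V × Fin n) p).real (infiniteHull σ ∅ z))
    (F : Finset V) : (bernoulliPercolation (V × Fin n) p).real (infiniteClustersMeet σ F) = 0 := by
  set P := bernoulliPercolation (V × Fin n) p
  set B := infiniteClustersMeet σ F
  have h1 : Tendsto (fun z => P.real (B ∩ infiniteHull σ ∅ z)) cofinite (𝓝 0) := by
    have hlim : Tendsto (fun z => ∑ f ∈ F, P.real (connectedEvent σ z f)) cofinite (𝓝 0) := by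
      simpa using tendsto_finsetSum (f := fun f z => P.real (connectedEvent σ z f)) F
        fun f _ => hτ f
    refine squeeze_zero (fun _ => measureReal_nonneg) (fun z => ?_) hlim
    refine (measureReal_mono ?_ (measure_ne_top _ _)).trans
      (measureReal_biUnion_finset_le _ _)
    rintro ω ⟨hB, hz⟩
    obtain ⟨f, hf, h⟩ := hB z hz
    exact Set.mem_biUnion hf h
  have h2 : Tendsto (fun z => P.real B * P.real (infiniteHull σ ∅ z)) cofinite (𝓝 0) := by
    have h := h1.sub (tendsto_real_infiniteHull_inter_sub hτ
      (measurableSet_infiniteClustersMeet (σ := σ) F))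
    rw [sub_zero] at h
    exact h.congr fun z => sub_sub_cancel _ _
  have h3 : P.real B * c ≤ 0 := ge_of_tendsto' h2 fun z =>
    mul_le_mul_of_nonneg_left (hinf z) measureReal_nonneg
  exact le_antisymm (nonpos_of_mul_nonpos_left h3 hc) measureReal_nonneg

/-- Percolation on the multigraph generated by permutations of a countable set, with adjacency
operator of norm at most `t`: between `1 / (2n - t + 1)` and `1 / t` there are almost surely
infinitely many infinite clusters. -/
theorem ae_infinite_setOf_infinite_component [Countable V] [Nonempty V] {p : unitInterval} {t : ℝ}
    (ht : 0 ≤ t) (hσ : AdjBound σ t) (hp0 : 0 < p) (hp1 : p < 1) (hh : 0 < 2 * (n : ℝ) - t)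
    (hlower : 1 / ((2 * (n : ℝ) - t) + 1) < p) (hupper : p * t < 1) :
    ∀ᵐ ω ∂(bernoulliPercolation (V × Fin n) p),
      {C : (edgeGraph σ (openEdges ω)).ConnectedComponent | C.supp.Infinite}.Infinite := by
  classical
  have hexp := hσ.boundary_le ht
  -- A finite nonempty vertex set would have empty boundary, contradicting `h > 0`.
  have : Infinite V := by
    by_contra hfin
    rw [not_infinite_iff_finite] at hfin
    have := Fintype.ofFinite V
    have h := hexp Finset.univ
    have hb : boundary σ (Finset.univ : Finset V) = ∅ := by
      ext q; simp [mem_boundary]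
    rw [hb, Finset.card_empty, Nat.cast_zero] at h
    have hV : (0 : ℝ) < (Finset.univ : Finset V).card := by
      exact_mod_cast Finset.univ_nonempty.card_pos
    exact absurd h (not_le.2 (mul_pos hh hV))
  obtain ⟨c, hc, hinf⟩ := exists_le_real_infinite_hull hexp hh hp0 hp1 hlower
  have hτ := fun w => tendsto_real_reachable ht hσ hupper w
  have hzero : ∀ F : Finset V,
      bernoulliPercolation (V × Fin n) p (infiniteClustersMeet σ F) = 0 := fun F =>
    (measureReal_eq_zero_iff (measure_ne_top _ _)).1
      (real_infiniteClustersMeet_eq_zero hτ hc hinf F)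
  refine measure_mono_null (fun ω hω => ?_) (measure_iUnion_null hzero)
  have hfin : {C : (edgeGraph σ (openEdges ω)).ConnectedComponent | C.supp.Infinite}.Finite :=
    Set.not_infinite.1 hω
  -- `F` consists of one representative of each infinite cluster.
  refine Set.mem_iUnion.2 ⟨hfin.toFinset.image Quot.out, fun z hz => ?_⟩
  let C := (edgeGraph σ (openEdges ω)).connectedComponentMk z
  refine ⟨Quot.out C, Finset.mem_image_of_mem _ (hfin.mem_toFinset.2 ?_), ?_⟩
  · refine hz.mono ?_
    rintro w ⟨c, rfl, hw⟩
    rw [Set.sdiff_empty] at hw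
    exact SimpleGraph.ConnectedComponent.sound hw.symm
  · exact SimpleGraph.ConnectedComponent.exact (Quot.out_eq C).symm

end Clusters

/-! ### Mass transport on the relation. -/

section MassTransport

variable {X : Type*} [MeasurableSpace X]

/-- The points at which `γ k` is the first of the maps `γ` with its value. -/
def firstIndexSet {R : Setoid X} (γ : ℕ → FullGroup R) (k : ℕ) : Set X :=
  {x | ∀ j < k, (γ j).1 x ≠ (γ k).1 x}

theorem tsum_classVertex {R : Setoid X} {γ : ℕ → FullGroup R}
    (hγ : ∀ x y, R x y → ∃ k, (γ k).1 x = y) (g : X → ENNReal) (x : X) :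
    ∑' y : ClassVertex R x, g y.1 =
      ∑' k, (firstIndexSet γ k).indicator (fun x => g ((γ k).1 x)) x := by
  classical
  let ψ : {k | x ∈ firstIndexSet γ k} → ClassVertex R x :=
    fun k => ⟨(γ k.1).1 x, (γ k.1).2 x⟩
  have hψ : Function.Bijective ψ := by
    constructor
    · rintro ⟨k, hk⟩ ⟨l, hl⟩ hkl
      have hkl' : (γ k).1 x = (γ l).1 x := congrArg Subtype.val hkl
      rcases lt_trichotomy k l with h | h | h
      · exact absurd hkl' (hl k h)
      · exact Subtype.ext h
      · exact absurd hkl'.symm (hk l h)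
    · rintro ⟨y, hy⟩
      have hex := hγ x y hy
      have hfind := Nat.find_spec hex
      exact ⟨⟨Nat.find hex, fun j hj h => Nat.find_min hex hj (h.trans hfind)⟩,
        Subtype.ext hfind⟩
  rw [← (Equiv.ofBijective ψ hψ).tsum_eq]
  exact tsum_subtype {k | x ∈ firstIndexSet γ k} fun k => g ((γ k).1 x)

/-- The class of `y` is listed backwards: each `w` occurs once, for the least `k` with `γ k w = y`.
Seen from `w`, this is the same index as in `tsum_classVertex`. -/
theorem tsum_classVertex_symm {R : Setoid X} {γ : ℕ → FullGroup R}
    (hγ : ∀ x y, R x y → ∃ k, (γ k).1 x = y) (g : X → ENNReal) (y : X) :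
    ∑' w : ClassVertex R y, g w.1 =
      ∑' k, (firstIndexSet γ k).indicator g ((γ k).1.symm y) := by
  classical
  let ψ : {k | (γ k).1.symm y ∈ firstIndexSet γ k} → ClassVertex R y :=
    fun k => ⟨(γ k.1).1.symm y, (γ k.1).inv.2 y⟩
  have hψ : Function.Bijective ψ := by
    constructor
    · rintro ⟨k, hk⟩ ⟨l, hl⟩ hkl
      have hkl' : (γ k).1.symm y = (γ l).1.symm y := congrArg Subtype.val hkl
      rcases lt_trichotomy k l with h | h | h
      · refine absurd ?_ (hl k h)
        rw [← hkl', MeasurableEquiv.apply_symm_apply, hkl', MeasurableEquiv.apply_symm_apply]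
      · exact Subtype.ext h
      · refine absurd ?_ (hk l h)
        rw [hkl', MeasurableEquiv.apply_symm_apply, ← hkl', MeasurableEquiv.apply_symm_apply]
    · rintro ⟨w, hw⟩
      have hex := hγ w y (R.symm' hw)
      have hfind := Nat.find_spec hex
      have hw' : (γ (Nat.find hex)).1.symm y = w := by
        rw [MeasurableEquiv.symm_apply_eq]; exact hfind.symm
      refine ⟨⟨Nat.find hex, ?_⟩, Subtype.ext hw'⟩
      change _ ∈ firstIndexSet γ _
      rw [hw']
      exact fun j hj h => Nat.find_min hex hj (h.trans hfind)
  rw [← (Equiv.ofBijective ψ hψ).tsum_eq]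
  exact tsum_subtype {k | (γ k).1.symm y ∈ firstIndexSet γ k} fun k => g ((γ k).1.symm y)

variable [StandardBorelSpace X]

theorem measurableSet_firstIndexSet {R : Setoid X} (γ : ℕ → FullGroup R) (k : ℕ) :
    MeasurableSet (firstIndexSet γ k) := by
  have h := measurableSet_first_index γ (γ k).1.measurable k
  simp only [true_and] at h
  exact h

theorem measurable_tsum_classVertex {R : Setoid X} {γ : ℕ → FullGroup R}
    (hγ : ∀ x y, R x y → ∃ k, (γ k).1 x = y) {G : X × X → ENNReal} (hG : Measurable G) :
    Measurable fun y => ∑' w : ClassVertex R y, G (w.1, y) := by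
  have : (fun y => ∑' w : ClassVertex R y, G (w.1, y)) =
      fun y => ∑' k, (firstIndexSet γ k).indicator (fun x => G ((γ k).1 x, x)) y := by
    funext y
    rw [tsum_classVertex hγ fun w => G (w, y)]
    rfl
  rw [this]
  exact Measurable.tsum fun k => (hG.comp ((γ k).1.measurable.prodMk measurable_id)).indicator
    (measurableSet_firstIndexSet γ k)

/-- The mass transport principle. -/
theorem lintegral_tsum_classVertex_swap {R : Setoid X} {μ : Measure X} (hR : IsCountablePMP R μ)
    {γ : ℕ → FullGroup R} (hγ : ∀ x y, R x y → ∃ k, (γ k).1 x = y) {G : X × X → ENNReal}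
    (hG : Measurable G) :
    ∫⁻ x, ∑' y : ClassVertex R x, G (x, y.1) ∂μ =
      ∫⁻ y, ∑' w : ClassVertex R y, G (w.1, y) ∂μ := by
  have hleft : ∀ x, ∑' y : ClassVertex R x, G (x, y.1) =
      ∑' k, (firstIndexSet γ k).indicator (fun x => G (x, (γ k).1 x)) x := fun x =>
    tsum_classVertex hγ (fun y => G (x, y)) x
  have hright : ∀ y, ∑' w : ClassVertex R y, G (w.1, y) =
      ∑' k, (firstIndexSet γ k).indicator (fun w => G (w, y)) ((γ k).1.symm y) := fun y =>
    tsum_classVertex_symm hγ (fun w => G (w, y)) y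
  have hm : ∀ k, Measurable ((firstIndexSet γ k).indicator fun x => G (x, (γ k).1 x)) := fun k =>
    (hG.comp (measurable_id.prodMk (γ k).1.measurable)).indicator (measurableSet_firstIndexSet γ k)
  have heq : ∀ k y, (firstIndexSet γ k).indicator (fun w => G (w, y)) ((γ k).1.symm y) =
      (firstIndexSet γ k).indicator (fun x => G (x, (γ k).1 x)) ((γ k).1.symm y) := by
    intro k y
    simp [Set.indicator]
  simp_rw [hleft, hright, heq]
  have hm' : ∀ k, Measurable fun y =>
      (firstIndexSet γ k).indicator (fun x => G (x, (γ k).1 x)) ((γ k).1.symm y) := fun k =>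
    (hm k).comp (γ k).1.symm.measurable
  rw [lintegral_tsum fun k => (hm k).aemeasurable, lintegral_tsum fun k => (hm' k).aemeasurable]
  refine tsum_congr fun k => ?_
  -- The two `k`-th terms differ by the measure preserving change of variable `x = (γ k)⁻¹ y`.
  exact ((hR.measurePreserving (γ k).inv).lintegral_comp (hm k)).symm

theorem lintegral_fibreCount (R : Setoid X) (x : X) (G : X × X → ENNReal) :
    ∫⁻ q, G q.1 ∂(fibreCount R x) = ∑' y : ClassVertex R x, G (x, y.1) := by
  have hm : MeasurableSet {q : RelSpace R | q.1.1 = x} :=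
    (measurable_fst.comp measurable_subtype_coe) (measurableSet_singleton x)
  rw [fibreCount, ← lintegral_indicator hm, lintegral_count,
    ← tsum_subtype {q : RelSpace R | q.1.1 = x} fun q => G q.1]
  let e : ClassVertex R x ≃ {q : RelSpace R | q.1.1 = x} :=
    { toFun := fun y => ⟨⟨(x, y.1), y.2⟩, rfl⟩
      invFun := fun q => ⟨q.1.1.2, by
        have h1 := q.1.2
        have h2 : q.1.1.1 = x := q.2
        rwa [h2] at h1⟩
      left_inv := fun y => rfl
      right_inv := by
        rintro ⟨⟨⟨a, b⟩, hab⟩, hx⟩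
        obtain rfl : a = x := hx
        rfl }
  exact (e.tsum_eq fun q => G q.1.1).symm

/-- `T` moves only the first coordinate, so the fibres it preserves are those over the second one;
mass transport allows integrating along them. -/
theorem lintegral_relMeasure {R : Setoid X} {n : ℕ} {θ : Fin n → FullGroup R} {μ : Measure X}
    (hR : IsCountablePMP R μ) (hgen : IsGeneratedBy R θ) {G : X × X → ENNReal}
    (hG : Measurable G) :
    ∫⁻ q, G q.1 ∂(relMeasure R μ) = ∫⁻ y, ∑' w : ClassVertex R y, G (w.1, y) ∂μ := by
  obtain ⟨γ, hγ⟩ := exists_enumeration hgen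
  have hG' : Measurable fun q : RelSpace R => G q.1 := hG.comp measurable_subtype_coe
  rw [relMeasure, Measure.lintegral_bind (measurable_fibreCount hgen).aemeasurable
    hG'.aemeasurable]
  simp_rw [lintegral_fibreCount]
  exact lintegral_tsum_classVertex_swap hR hγ hG

end MassTransport

/-! ### The operator `T` as a sum over signed generators. -/

section Operator

variable {X : Type*} [MeasurableSpace X]

/-- The permutations of the class of `x` given by the generators. -/
def classPerm {R : Setoid X} {n : ℕ} (θ : Fin n → FullGroup R) (x : X) (i : Fin n) :
    Equiv.Perm (ClassVertex R x) where
  toFun v := ⟨(θ i).1 v.1, R.trans' v.2 ((θ i).2 v.1)⟩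
  invFun v := ⟨(θ i).1.symm v.1, R.trans' v.2 ((θ i).inv.2 v.1)⟩
  left_inv v := Subtype.ext ((θ i).1.symm_apply_apply v.1)
  right_inv v := Subtype.ext ((θ i).1.apply_symm_apply v.1)

/-- The generators and their inverses. -/
def signedGen {R : Setoid X} {n : ℕ} (θ : Fin n → FullGroup R) (s : Fin n × Bool) :
    FullGroup R :=
  if s.2 then θ s.1 else (θ s.1).inv

theorem coe_genStep_classPerm {R : Setoid X} {n : ℕ} (θ : Fin n → FullGroup R) (x : X)
    (s : Fin n × Bool) (v : ClassVertex R x) :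
    (genStep (classPerm θ x) s v).1 = (signedGen θ s).1 v.1 := by
  rcases s with ⟨i, b⟩
  cases b <;> rfl

theorem generatorSum_toLp {R : Setoid X} {n : ℕ} {θ : Fin n → FullGroup R} {μ : Measure X}
    (hR : IsCountablePMP R μ) {f : RelSpace R → ℂ} (hf : MemLp f 2 (relMeasure R μ)) :
    generatorSum hR θ (hf.toLp f) =ᵐ[relMeasure R μ]
      fun q => ∑ s : Fin n × Bool, f (leftMap (signedGen θ s) q) := by
  have h1 : ∀ g : FullGroup R, fullGroupRep hR g (hf.toLp f) =ᵐ[relMeasure R μ]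
      fun q => f (leftMap g.inv q) := fun g =>
    (hf.comp_measurePreserving (measurePreserving_leftMap hR g.inv)).coeFn_toLp
  have h2 : ∀ t : Finset (Fin n),
      ((∑ i ∈ t, (fullGroupRep hR (θ i) + fullGroupRep hR (θ i).inv)) (hf.toLp f) : L2Rel R μ)
        =ᵐ[relMeasure R μ]
      fun q => ∑ i ∈ t, (f (leftMap (θ i).inv q) + f (leftMap (θ i) q)) := by
    intro t
    induction t using Finset.induction_on with
    | empty =>
      simp only [Finset.sum_empty]
      exact Lp.coeFn_zero ℂ 2 (relMeasure R μ)
    | insert i t hi ih =>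
      rw [Finset.sum_insert hi, add_apply, add_apply]
      filter_upwards [ih, h1 (θ i), h1 (θ i).inv, Lp.coeFn_add (fullGroupRep hR (θ i) (hf.toLp f) +
        fullGroupRep hR (θ i).inv (hf.toLp f)) ((∑ i ∈ t, (fullGroupRep hR (θ i) +
        fullGroupRep hR (θ i).inv)) (hf.toLp f)), Lp.coeFn_add (fullGroupRep hR (θ i) (hf.toLp f))
        (fullGroupRep hR (θ i).inv (hf.toLp f))] with q e1 e2 e3 e4 e5
      rw [e4, Pi.add_apply, e5, Pi.add_apply, e1, e2, e3, Finset.sum_insert hi]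
      rfl
  refine (h2 Finset.univ).trans (Filter.EventuallyEq.of_eq ?_)
  funext q
  rw [Fintype.sum_prod_type]
  refine Finset.sum_congr rfl fun i _ => ?_
  rw [Fintype.sum_bool, add_comm]
  rfl

theorem norm_generatorSum_le {R : Setoid X} {n : ℕ} (θ : Fin n → FullGroup R) {μ : Measure X}
    (hR : IsCountablePMP R μ) : ‖generatorSum hR θ‖ ≤ 2 * n := by
  have h : ∀ g : FullGroup R, ‖fullGroupRep hR g‖ ≤ 1 := fun g =>
    LinearIsometry.norm_toContinuousLinearMap_le _
  calc ‖generatorSum hR θ‖ ≤ ∑ _i : Fin n, (1 + 1 : ℝ) :=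
        norm_sum_le_of_le _ fun i _ => norm_add_le_of_le (h _) (h _)
    _ = 2 * n := by simp; ring

theorem lintegral_enorm_sq_generatorSum_le {R : Setoid X} {n : ℕ} {θ : Fin n → FullGroup R}
    {μ : Measure X} (hR : IsCountablePMP R μ) {f : RelSpace R → ℂ} (hf : Measurable f)
    (hfin : ∫⁻ q, ‖f q‖ₑ ^ 2 ∂(relMeasure R μ) ≠ ⊤) :
    ∫⁻ q, ‖∑ s : Fin n × Bool, f (leftMap (signedGen θ s) q)‖ₑ ^ 2 ∂(relMeasure R μ) ≤
      ENNReal.ofReal ‖generatorSum hR θ‖ ^ 2 * ∫⁻ q, ‖f q‖ₑ ^ 2 ∂(relMeasure R μ) := by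
  have hsq : ∀ g : RelSpace R → ℂ,
      ∫⁻ q, ‖g q‖ₑ ^ 2 ∂(relMeasure R μ) = eLpNorm g 2 (relMeasure R μ) ^ 2 := by
    intro g
    have := eLpNorm_nnreal_pow_eq_lintegral (f := g) (μ := relMeasure R μ) (p := 2) two_ne_zero
    simpa using this.symm
  have hmem : MemLp f 2 (relMeasure R μ) := by
    refine ⟨hf.aestronglyMeasurable, ?_⟩
    rw [hsq] at hfin
    exact lt_top_iff_ne_top.2 fun h => hfin (by simp [h])
  rw [hsq, hsq, ← mul_pow, ← eLpNorm_congr_ae (generatorSum_toLp hR hmem),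
    ← eLpNorm_congr_ae hmem.coeFn_toLp, ← Lp.enorm_def, ← Lp.enorm_def, ofReal_norm]
  exact pow_le_pow_left' ((generatorSum hR θ).le_opENorm _) 2

end Operator

/-! ### From the norm of `T` to the adjacency operator of almost every class. -/

section Transfer

variable {X : Type*} [MeasurableSpace X]

open Classical in
/-- The function on the class of `y` which takes the value `∑ c k` at `w`, the sum being over the
indices `k` with `γ k y = w`. -/
noncomputable def patternFun {R : Setoid X} (γ : ℕ → FullGroup R) (c : ℕ →₀ ℕ) (q : X × X) : ℕ :=
  c.sum fun k m => if (γ k).1 q.2 = q.1 then m else 0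

theorem tsum_patternFun_sq_le {R : Setoid X} (γ : ℕ → FullGroup R) (c : ℕ →₀ ℕ) (y : X) :
    ∑' w : ClassVertex R y, (patternFun γ c (w.1, y) : ENNReal) ^ 2 ≤
      ((c.sum fun _ m => m : ℕ) : ENNReal) ^ 2 := by
  classical
  set M := c.sum fun _ m => m with hM
  have hle : ∀ w, patternFun γ c (w, y) ≤ M := fun w =>
    Finset.sum_le_sum fun k _ => by
      change (if _ then c k else 0) ≤ c k
      split_ifs <;> simp
  have hsum : ∑' w : ClassVertex R y, (patternFun γ c (w.1, y) : ENNReal) = M := by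
    simp only [patternFun, Finsupp.sum, Nat.cast_sum]
    rw [Summable.tsum_finsetSum fun _ _ => ENNReal.summable, hM, Finsupp.sum, Nat.cast_sum]
    refine Finset.sum_congr rfl fun k _ => ?_
    rw [tsum_eq_single (⟨(γ k).1 y, (γ k).2 y⟩ : ClassVertex R y)]
    · simp
    · intro w hw
      rw [if_neg fun h => hw (Subtype.ext h.symm)]
      simp
  calc ∑' w : ClassVertex R y, (patternFun γ c (w.1, y) : ENNReal) ^ 2
      ≤ ∑' w : ClassVertex R y, (M : ENNReal) * patternFun γ c (w.1, y) := by
        refine ENNReal.tsum_le_tsum fun w => ?_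
        rw [sq]
        exact mul_le_mul_left (by exact_mod_cast hle w.1) _
    _ = _ := by rw [ENNReal.tsum_mul_left, hsum, sq]

/-- This is why `AdjBound` tests `ℕ`-valued functions only: the countably many `c` then give every
test function on every class. -/
theorem exists_patternFun_eq {R : Setoid X} {γ : ℕ → FullGroup R}
    (hγ : ∀ x y, R x y → ∃ k, (γ k).1 x = y) (y : X) {f : ClassVertex R y → ℕ}
    (hf : f.support.Finite) : ∃ c, ∀ w : ClassVertex R y, patternFun γ c (w.1, y) = f w := by
  classical
  choose k hk using fun w : ClassVertex R y => hγ y w.1 w.2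
  have hinj : Function.Injective k := fun v w h => Subtype.ext (by rw [← hk v, ← hk w, h])
  refine ⟨Finsupp.embDomain ⟨k, hinj⟩ (Finsupp.ofSupportFinite f hf), fun w => ?_⟩
  rw [patternFun, Finsupp.sum_embDomain]
  simp only [Function.Embedding.coeFn_mk, hk]
  rw [Finsupp.sum, Finset.sum_eq_single w]
  · rw [if_pos rfl]
    rfl
  · intro v _ hvw
    exact if_neg fun h => hvw (Subtype.ext h)
  · intro hw
    rw [if_pos rfl]
    simpa using hw

variable [StandardBorelSpace X]

theorem lintegral_tsum_generators_le {R : Setoid X} {n : ℕ} {θ : Fin n → FullGroup R}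
    {μ : Measure X} (hR : IsCountablePMP R μ) (hgen : IsGeneratedBy R θ) {Φ : X × X → ℕ}
    (hΦ : Measurable Φ)
    (hfin : ∫⁻ y, ∑' w : ClassVertex R y, (Φ (w.1, y) : ENNReal) ^ 2 ∂μ ≠ ⊤) :
    ∫⁻ y, ∑' w : ClassVertex R y,
        ((∑ s : Fin n × Bool, Φ ((signedGen θ s).1 w.1, y) : ℕ) : ENNReal) ^ 2 ∂μ ≤
      ENNReal.ofReal ‖generatorSum hR θ‖ ^ 2 *
        ∫⁻ y, ∑' w : ClassVertex R y, (Φ (w.1, y) : ENNReal) ^ 2 ∂μ := by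
  have henorm : ∀ m : ℕ, ‖(m : ℂ)‖ₑ = m := fun m => by
    rw [← ofReal_norm, Complex.norm_natCast, ENNReal.ofReal_natCast]
  have hcast : Measurable fun m : ℕ => (m : ENNReal) ^ 2 := measurable_of_countable _
  have hΦ2 : Measurable fun q : X × X => ∑ s : Fin n × Bool, Φ ((signedGen θ s).1 q.1, q.2) :=
    Finset.measurable_sum _ fun s _ =>
      hΦ.comp (((signedGen θ s).1.measurable.comp measurable_fst).prodMk measurable_snd)
  have e1 := lintegral_relMeasure hR hgen (G := fun q => (Φ q : ENNReal) ^ 2) (hcast.comp hΦ)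
  have e2 := lintegral_relMeasure hR hgen (G := fun q =>
    ((∑ s : Fin n × Bool, Φ ((signedGen θ s).1 q.1, q.2) : ℕ) : ENNReal) ^ 2) (hcast.comp hΦ2)
  have hf : Measurable fun q : RelSpace R => (Φ q.1 : ℂ) :=
    (measurable_of_countable fun m : ℕ => (m : ℂ)).comp (hΦ.comp measurable_subtype_coe)
  have h := lintegral_enorm_sq_generatorSum_le (θ := θ) hR hf
  simp only [henorm, ← Nat.cast_sum] at h
  rw [e1] at h
  rw [← e2]
  exact h hfin

theorem ae_tsum_generators_le {R : Setoid X} {n : ℕ} {θ : Fin n → FullGroup R}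
    {μ : Measure X} [SigmaFinite μ] (hR : IsCountablePMP R μ) (hgen : IsGeneratedBy R θ)
    {Φ : X × X → ℕ} (hΦ : Measurable Φ)
    (hfin : ∫⁻ y, ∑' w : ClassVertex R y, (Φ (w.1, y) : ENNReal) ^ 2 ∂μ ≠ ⊤) :
    ∀ᵐ y ∂μ, ∑' w : ClassVertex R y,
        ((∑ s : Fin n × Bool, Φ ((signedGen θ s).1 w.1, y) : ℕ) : ENNReal) ^ 2 ≤
      ENNReal.ofReal ‖generatorSum hR θ‖ ^ 2 *
        ∑' w : ClassVertex R y, (Φ (w.1, y) : ENNReal) ^ 2 := by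
  classical
  obtain ⟨γ, hγ⟩ := exists_enumeration hgen
  have hcast : Measurable fun m : ℕ => (m : ENNReal) ^ 2 := measurable_of_countable _
  have hΦ2 : Measurable fun q : X × X => ∑ s : Fin n × Bool, Φ ((signedGen θ s).1 q.1, q.2) :=
    Finset.measurable_sum _ fun s _ =>
      hΦ.comp (((signedGen θ s).1.measurable.comp measurable_fst).prodMk measurable_snd)
  have hm1 := measurable_tsum_classVertex hγ (G := fun q => (Φ q : ENNReal) ^ 2) (hcast.comp hΦ)
  have hm2 := measurable_tsum_classVertex hγ (G := fun q =>
    ((∑ s : Fin n × Bool, Φ ((signedGen θ s).1 q.1, q.2) : ℕ) : ENNReal) ^ 2) (hcast.comp hΦ2)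
  refine ae_le_of_forall_setLIntegral_le_of_sigmaFinite hm2 fun B hB _ => ?_
  rw [lintegral_const_mul _ hm1, ← lintegral_indicator hB, ← lintegral_indicator hB]
  -- Cutting off by a set of second coordinates commutes with `T`. The integrated inequality thus
  -- holds over every measurable `B`, hence almost everywhere.
  let Ψ : X × X → ℕ := fun q => if q.2 ∈ B then Φ q else 0
  have hΨ : Measurable Ψ := Measurable.ite (measurable_snd hB) hΦ measurable_const
  have h1 : ∀ y, ∑' w : ClassVertex R y, (Ψ (w.1, y) : ENNReal) ^ 2 =
      B.indicator (fun y => ∑' w : ClassVertex R y, (Φ (w.1, y) : ENNReal) ^ 2) y := by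
    intro y
    by_cases hy : y ∈ B <;> simp [Ψ, hy]
  have h2 : ∀ y, ∑' w : ClassVertex R y,
      ((∑ s : Fin n × Bool, Ψ ((signedGen θ s).1 w.1, y) : ℕ) : ENNReal) ^ 2 =
      B.indicator (fun y => ∑' w : ClassVertex R y,
        ((∑ s : Fin n × Bool, Φ ((signedGen θ s).1 w.1, y) : ℕ) : ENNReal) ^ 2) y := by
    intro y
    by_cases hy : y ∈ B <;> simp [Ψ, hy]
  have h := lintegral_tsum_generators_le hR hgen hΨ
  simp_rw [h1, h2] at h
  refine h (ne_top_of_le_ne_top hfin (lintegral_mono fun y => ?_))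
  exact Set.indicator_le_self' (fun _ _ => zero_le) y

theorem measurable_patternFun {R : Setoid X} (γ : ℕ → FullGroup R) (c : ℕ →₀ ℕ) :
    Measurable (patternFun γ c) := by
  classical
  refine Finset.measurable_sum _ fun k _ => ?_
  exact Measurable.ite (measurableSet_eq_fun ((γ k).1.measurable.comp measurable_snd)
    measurable_fst) measurable_const measurable_const

/-- On almost every class, the adjacency operator is bounded by the norm of `T`. -/
theorem ae_adjBound {R : Setoid X} {n : ℕ} {θ : Fin n → FullGroup R}
    {μ : Measure X} [IsFiniteMeasure μ] (hR : IsCountablePMP R μ) (hgen : IsGeneratedBy R θ) :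
    ∀ᵐ x ∂μ, AdjBound (classPerm θ x) ‖generatorSum hR θ‖ := by
  obtain ⟨γ, hγ⟩ := exists_enumeration hgen
  have h : ∀ᵐ y ∂μ, ∀ c : ℕ →₀ ℕ, ∑' w : ClassVertex R y,
        ((∑ s : Fin n × Bool, patternFun γ c ((signedGen θ s).1 w.1, y) : ℕ) : ENNReal) ^ 2 ≤
      ENNReal.ofReal ‖generatorSum hR θ‖ ^ 2 *
        ∑' w : ClassVertex R y, (patternFun γ c (w.1, y) : ENNReal) ^ 2 := by
    refine ae_all_iff.2 fun c => ae_tsum_generators_le hR hgen (measurable_patternFun γ c) ?_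
    refine ne_top_of_le_ne_top ?_ (lintegral_mono (tsum_patternFun_sq_le γ c))
    rw [lintegral_const]
    exact ENNReal.mul_ne_top (ENNReal.pow_ne_top (ENNReal.natCast_ne_top _)) (measure_ne_top _ _)
  filter_upwards [h] with x hx f hf
  obtain ⟨c, hc⟩ := exists_patternFun_eq hγ x hf
  have := hx c
  simp only [← coe_genStep_classPerm, hc] at this
  exact this

end Transfer

/-! ### Measurability of the cluster event. -/

section Event

variable {X : Type*} [MeasurableSpace X]

theorem openSubgraph_eq_edgeGraph {R : Setoid X} {n : ℕ} (θ : Fin n → FullGroup R) {x : X}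
    (ω : ClassEdge R n x → Bool) :
    openSubgraph θ ω = edgeGraph (classPerm θ x) (openEdges ω) := by
  unfold openSubgraph edgeGraph
  congr 1
  funext y z
  simp only [Subtype.ext_iff]
  rfl

/-- Infinitude is expressed by countable operations along an enumeration that may repeat itself. -/
theorem infinite_iff_forall_exists_new {β : Type*} {g : ℕ → β} (hg : Function.Surjective g)
    (S : Set β) : S.Infinite ↔ ∀ M : ℕ, ∃ k, g k ∈ S ∧ ∀ j < M, g j ≠ g k := by
  constructor
  · intro hS M
    by_contra! h
    refine hS (((Set.finite_Iio M).image g).subset fun b hb => ?_)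
    obtain ⟨k, rfl⟩ := hg b
    obtain ⟨j, hj, hjk⟩ := h k hb
    exact ⟨j, hj, hjk⟩
  · intro h hS
    choose i hi using hg
    obtain ⟨M, hM⟩ := (hS.image i).bddAbove
    obtain ⟨k, hk, hnew⟩ := h (M + 1)
    exact hnew (i (g k)) (Nat.lt_succ_of_le (hM ⟨_, hk, rfl⟩)) (hi _)

theorem measurable_root (R : Setoid X) (n : ℕ) :
    Measurable (PercolationSpace.root (R := R) (n := n)) :=
  Measurable.of_comap_le le_sup_left

theorem measurable_config_apply {R : Setoid X} {n : ℕ} (γ : FullGroup R) (i : Fin n) :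
    Measurable fun z : PercolationSpace R n => z.config (⟨γ.1 z.root, γ.2 z.root⟩, i) :=
  Measurable.of_comap_le (le_sup_of_le_right (le_iSup₂_of_le γ i le_rfl))

/-- The `k`-th vertex of the class of the root. -/
def rootVertex {R : Setoid X} {n : ℕ} (γ : ℕ → FullGroup R) (z : PercolationSpace R n) (k : ℕ) :
    ClassVertex R z.root :=
  ⟨(γ k).1 z.root, (γ k).2 z.root⟩

theorem rootVertex_surjective {R : Setoid X} {n : ℕ} {γ : ℕ → FullGroup R}
    (hγ : ∀ x y, R x y → ∃ k, (γ k).1 x = y) (z : PercolationSpace R n) :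
    Function.Surjective (rootVertex γ z) := by
  rintro ⟨y, hy⟩
  obtain ⟨k, hk⟩ := hγ _ _ hy
  exact ⟨k, Subtype.ext hk⟩

variable [StandardBorelSpace X]

theorem measurableSet_root_eq {R : Setoid X} {n : ℕ} {f g : X → X} (hf : Measurable f)
    (hg : Measurable g) : MeasurableSet {z : PercolationSpace R n | f z.root = g z.root} :=
  measurable_root R n (measurableSet_eq_fun hf hg)

theorem measurableSet_rootVertex_eq {R : Setoid X} {n : ℕ} (γ : ℕ → FullGroup R) (k l : ℕ) :
    MeasurableSet {z : PercolationSpace R n | rootVertex γ z k = rootVertex γ z l} := by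
  simp only [rootVertex, Subtype.mk.injEq]
  exact measurableSet_root_eq (γ k).1.measurable (γ l).1.measurable

theorem measurableSet_reachable_rootVertex {R : Setoid X} {n : ℕ} (θ : Fin n → FullGroup R)
    {γ : ℕ → FullGroup R} (hγ : ∀ x y, R x y → ∃ k, (γ k).1 x = y) (k l : ℕ) :
    MeasurableSet {z : PercolationSpace R n |
      (openSubgraph θ z.config).Reachable (rootVertex γ z k) (rootVertex γ z l)} := by
  -- Reachability is moved to indices, whose set does not depend on `z`. Equality of vertices is
  -- allowed as a step because one vertex may have several indices.
  let a : PercolationSpace R n → ℕ → ℕ → Prop := fun z k l =>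
    rootVertex γ z k = rootVertex γ z l ∨
      (openSubgraph θ z.config).Adj (rootVertex γ z k) (rootVertex γ z l)
  have hiff : ∀ z : PercolationSpace R n,
      (openSubgraph θ z.config).Reachable (rootVertex γ z k) (rootVertex γ z l) ↔
        Relation.ReflTransGen (a z) k l := by
    intro z
    constructor
    · intro h
      rw [SimpleGraph.reachable_iff_reflTransGen] at h
      obtain ⟨w, hw⟩ : ∃ w, rootVertex γ z l = w := ⟨_, rfl⟩
      rw [hw] at h
      induction h generalizing l with
      | refl => exact Relation.ReflTransGen.single (Or.inl hw.symm)
      | tail _ hadj ih =>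
        rename_i b c _
        obtain ⟨j, hj⟩ := rootVertex_surjective hγ z b
        refine (ih j hj).tail (Or.inr ?_)
        rwa [hj, hw]
    · intro h
      induction h with
      | refl => exact SimpleGraph.Reachable.refl _
      | tail _ ha ih =>
        rcases ha with ha | ha
        · rwa [← ha]
        · exact ih.trans ha.reachable
  simp only [hiff]
  refine measurableSet_reflTransGen (fun k l => ?_) k l
  have hdir : ∀ k l, MeasurableSet {z : PercolationSpace R n |
      ∃ i, z.config (rootVertex γ z k, i) = true ∧
        (θ i).1 (rootVertex γ z k).1 = (rootVertex γ z l).1} := by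
    intro k l
    rw [Set.ofPred_exists]
    refine MeasurableSet.iUnion fun i => MeasurableSet.inter ?_ ?_
    · exact measurable_config_apply (γ k) i (measurableSet_singleton true)
    · exact measurableSet_root_eq ((θ i).1.measurable.comp (γ k).1.measurable) (γ l).1.measurable
  simp only [a, openSubgraph, SimpleGraph.fromRel_adj]
  exact (measurableSet_rootVertex_eq γ k l).union
    ((measurableSet_rootVertex_eq γ k l).compl.inter ((hdir k l).union (hdir l k)))

theorem measurableSet_hasInfinitelyManyInfiniteClusters {R : Setoid X} {n : ℕ}
    {θ : Fin n → FullGroup R} (hgen : IsGeneratedBy R θ) :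
    MeasurableSet {z : PercolationSpace R n | HasInfinitelyManyInfiniteClusters θ z.config} := by
  obtain ⟨γ, hγ⟩ := exists_enumeration hgen
  have hreach := measurableSet_reachable_rootVertex θ hγ
  have hinf : ∀ k, MeasurableSet {z : PercolationSpace R n |
      ((openSubgraph θ z.config).connectedComponentMk (rootVertex γ z k)).supp.Infinite} := by
    intro k
    have : {z : PercolationSpace R n |
        ((openSubgraph θ z.config).connectedComponentMk (rootVertex γ z k)).supp.Infinite} =
        ⋂ M : ℕ, ⋃ l : ℕ, {z | (openSubgraph θ z.config).Reachable (rootVertex γ z l)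
          (rootVertex γ z k)} ∩ ⋂ j ∈ Set.Iio M, {z | rootVertex γ z j = rootVertex γ z l}ᶜ := by
      ext z
      rw [Set.mem_ofPred_eq, infinite_iff_forall_exists_new (rootVertex_surjective hγ z)]
      simp
    rw [this]
    exact MeasurableSet.iInter fun M => MeasurableSet.iUnion fun l => (hreach l k).inter
      (MeasurableSet.biInter (Set.to_countable _) fun j _ =>
        (measurableSet_rootVertex_eq γ j l).compl)
  have : {z : PercolationSpace R n | HasInfinitelyManyInfiniteClusters θ z.config} =
      ⋂ M : ℕ, ⋃ k : ℕ, {z | ((openSubgraph θ z.config).connectedComponentMk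
        (rootVertex γ z k)).supp.Infinite} ∩ ⋂ j ∈ Set.Iio M,
          {z | (openSubgraph θ z.config).Reachable (rootVertex γ z j) (rootVertex γ z k)}ᶜ := by
    ext z
    have hsurj : Function.Surjective fun k =>
        (openSubgraph θ z.config).connectedComponentMk (rootVertex γ z k) :=
      Quot.mk_surjective.comp (rootVertex_surjective hγ z)
    rw [Set.mem_ofPred_eq, HasInfinitelyManyInfiniteClusters,
      infinite_iff_forall_exists_new hsurj]
    simp
  rw [this]
  exact MeasurableSet.iInter fun M => MeasurableSet.iUnion fun k => (hinf k).inter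
    (MeasurableSet.biInter (Set.to_countable _) fun j _ => (hreach j k).compl)

end Event

end PercolationOnRelations

/-! ### Conclusion: integration over the classes. -/

theorem mainTheorem6 {X : Type*} [MeasurableSpace X] [StandardBorelSpace X]
    (μ : MeasureTheory.Measure X) [MeasureTheory.IsProbabilityMeasure μ]
    (R : Setoid X) (hR : PercolationOnRelations.IsCountablePMP R μ)
    (hErg : PercolationOnRelations.IsErgodicRel R μ)
    (n : ℕ) (θ : Fin n → PercolationOnRelations.FullGroup R)
    (hgen : PercolationOnRelations.IsGeneratedBy R θ)
    (p : unitInterval) (hp0 : 0 < p) (hp1 : p < 1)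
    (hlower : 1 / ((2 * (n : ℝ) - ‖PercolationOnRelations.generatorSum hR θ‖) + 1) < (p : ℝ))
    (hupper : (p : ℝ) < 1 / ‖PercolationOnRelations.generatorSum hR θ‖) :
    ∀ᵐ z ∂(PercolationOnRelations.percolationMeasure R n p μ),
      PercolationOnRelations.HasInfinitelyManyInfiniteClusters θ z.config := by
  open PercolationOnRelations in
  set t := ‖generatorSum hR θ‖ with ht_def
  have ht : 0 ≤ t := norm_nonneg _
  have hp0' : (0 : ℝ) < p := by exact_mod_cast hp0
  have hp1' : (p : ℝ) < 1 := by exact_mod_cast hp1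
  have htn : t ≤ 2 * n := norm_generatorSum_le θ hR
  -- For `t = 0` the upper bound `1 / t` is `0` by convention, which `p > 0` excludes.
  have htpos : 0 < t := by
    rcases ht.eq_or_lt with h | h
    · rw [← h, div_zero] at hupper
      exact absurd hupper hp0'.not_gt
    · exact h
  have hpt : (p : ℝ) * t < 1 := (lt_div_iff₀ htpos).1 hupper
  -- As `t ≤ 2n`, the denominator in `hlower` is positive, and `p < 1` makes it exceed `1`.
  have hh : 0 < 2 * (n : ℝ) - t := by
    have h1 := hlower.trans hp1'
    rw [div_lt_one (by linarith)] at h1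
    linarith
  have hmeas := measurableSet_hasInfinitelyManyInfiniteClusters hgen
  rw [ae_iff]
  refine (percolationMeasure_apply hgen p μ hmeas.compl).trans ?_
  refine (lintegral_congr_ae ?_).trans lintegral_zero
  filter_upwards [ae_adjBound hR hgen] with x hx
  have : Countable (ClassVertex R x) := (hR.countable_class x).to_subtype
  have : Nonempty (ClassVertex R x) := ⟨⟨x, R.refl' x⟩⟩
  have h := ae_infinite_setOf_infinite_component ht hx hp0 hp1 hh hlower hpt
  rw [ae_iff] at h
  refine Eq.trans ?_ h
  change bernoulliPercolation (ClassEdge R n x) p _ = _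
  congr 1
  ext ω
  change ¬ HasInfinitelyManyInfiniteClusters θ ω ↔ _
  rw [HasInfinitelyManyInfiniteClusters, openSubgraph_eq_edgeGraph]
  rfl
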